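/- Let $n$ be a natural number. An algebraic curvature operator on a Euclidean space $\mathbb{R}^m$ is a four-linear form $R$ satisfying $R(v_1,v_2,v_3,v_4) = -R(v_2,v_1,v_3,v_4) = R(v_3,v_4,v_1,v_2)$ and the first Bianchi identity $R(v_1,v_2,v_3,v_4)+R(v_1,v_3,v_4,v_2)+R(v_1,v_4,v_2,v_3)=0$; its components in the standard basis are denoted by $R_{ijkl}$. We say that $R$ has nonnegative isotropic curvature if $$R(e_1,e_3,e_1,e_3)+R(e_1,e_4,e_1,e_4)+R(e_2,e_3,e_2,e_3)+R(e_2,e_4,e_2,e_4)-2R(e_1,e_2,e_3,e_4)\ge 0$$ for all orthonormal four-frames $\{e_1,e_2,e_3,e_4\}$ in $\mathbb{R}^m$. Define the algebraic curvature operator $Q(R)$ by $$Q(R)_{ijkl}=\sum_{p,q}\big(R_{ijpq}R_{klpq}+2R_{ipkq}R_{jplq}-2R_{iplq}R_{jpkq}\big).$$ Given an algebraic curvature operator $R$ on $\mathbb{R}^n$, let $S$ be the induced algebraic curvature operator on $\mathbb{R}^n\times\mathbb{R}^2$ given by $$S(\hat v_1,\hat v_2,\hat v_3,\hat v_4)=R(v_1,v_2,v_3,v_4)+\langle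 x_1,x_3\rangle\langle x_2,x_4\rangle-\langle x_1,x_4\rangle\langle x_2,x_3\rangle,\qquad \hat v_j=(v_j,x_j),$$ and let $E$ be the set of all algebraic curvature operators $R$ on $\mathbb{R}^n$ for which $S$ has nonnegative isotropic curvature. Proposition. Let $0<T\le\infty$, and suppose that $R(t)$, $t\in[0,T)$, is a solution, in the space of algebraic curvature operators on $\mathbb{R}^n$, of the ODE $\frac{d}{dt}R(t)=Q(R(t))$ with $R(0)\in E$. Then $R(t)\in E$ for all $t\in[0,T)$. -/

import Mathlib

/-- The space `S_B²(𝔰𝔬(n))` of algebraic curvature operators on the Euclidean space with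
orthonormal coordinates indexed by `ι`, given by their components `R i j k l` in the standard
basis: antisymmetric in the first pair of indices, symmetric under exchange of the two pairs
(hence antisymmetric in the last pair too), with the first Bianchi identity. It is a
finite-dimensional space with the (sup) norm of components. -/
def AlgCurv (ι : Type*) : Submodule ℝ (ι → ι → ι → ι → ℝ) where
  carrier := {R | (∀ i j k l, R j i k l = -R i j k l) ∧ (∀ i j k l, R k l i j = R i j k l) ∧
    (∀ i j k l, R i j k l + R i k l j + R i l j k = 0)}
  add_mem' := by
    rintro a b ⟨a1, a2, a3⟩ ⟨b1, b2, b3⟩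
    refine ⟨fun i j k l => ?_, fun i j k l => ?_, fun i j k l => ?_⟩ <;>
      simp only [Pi.add_apply]
    · linarith [a1 i j k l, b1 i j k l]
    · linarith [a2 i j k l, b2 i j k l]
    · linarith [a3 i j k l, b3 i j k l]
  zero_mem' := by simp
  smul_mem' := by
    rintro c a ⟨a1, a2, a3⟩
    refine ⟨fun i j k l => ?_, fun i j k l => ?_, fun i j k l => ?_⟩ <;>
      simp only [Pi.smul_apply, smul_eq_mul]
    · rw [a1 i j k l]; ring
    · rw [a2 i j k l]
    · rw [← mul_add, ← mul_add, a3 i j k l, mul_zero]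

namespace AlgCurv

/-- The component `R_{ijkl}` in the standard basis. -/
def comp {ι : Type*} (R : AlgCurv ι) (i j k l : ι) : ℝ := (R : ι → ι → ι → ι → ℝ) i j k l

theorem comp_swap {ι : Type*} (R : AlgCurv ι) (i j k l : ι) :
    comp R j i k l = -comp R i j k l := R.2.1 i j k l

theorem comp_pair {ι : Type*} (R : AlgCurv ι) (i j k l : ι) :
    comp R k l i j = comp R i j k l := R.2.2.1 i j k l

theorem comp_bianchi {ι : Type*} (R : AlgCurv ι) (i j k l : ι) :
    comp R i j k l + comp R i k l j + comp R i l j k = 0 := R.2.2.2 i j k l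

/-- The value `R(v₁, v₂, v₃, v₄)`: the multilinear extension of the components. -/
def eval {ι : Type*} [Fintype ι] (R : AlgCurv ι) (v₁ v₂ v₃ v₄ : EuclideanSpace ℝ ι) : ℝ :=
  ∑ i, ∑ j, ∑ k, ∑ l, comp R i j k l * v₁ i * v₂ j * v₃ k * v₄ l

/-- `(R²)_{ijkl} = R_{ijpq} R_{klpq}`. -/
def sqTerm {ι : Type*} [Fintype ι] (R : AlgCurv ι) (i j k l : ι) : ℝ :=
  ∑ p, ∑ q, comp R i j p q * comp R k l p q

/-- `(R^#)_{ijkl} = 2 R_{ipkq} R_{jplq} - 2 R_{iplq} R_{jpkq}`. -/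
def sharpTerm {ι : Type*} [Fintype ι] (R : AlgCurv ι) (i j k l : ι) : ℝ :=
  ∑ p, ∑ q, (2 * comp R i p k q * comp R j p l q - 2 * comp R i p l q * comp R j p k q)

theorem Q_symmetries {ι : Type*} [Fintype ι] (R : AlgCurv ι) :
    (fun i j k l => sqTerm R i j k l + sharpTerm R i j k l) ∈ AlgCurv ι := by
  refine ⟨fun i j k l => ?_, fun i j k l => ?_, fun i j k l => ?_⟩
  · simp only [sqTerm, sharpTerm, ← Finset.sum_add_distrib, ← Finset.sum_neg_distrib]
    refine Finset.sum_congr rfl fun p _ => Finset.sum_congr rfl fun q _ => ?_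
    rw [comp_swap R i j p q]; ring
  · have h : sharpTerm R k l i j = sharpTerm R i j k l := by
      simp only [sharpTerm]
      rw [Finset.sum_comm]
      refine Finset.sum_congr rfl fun p _ => Finset.sum_congr rfl fun q _ => ?_
      rw [comp_pair R i p k q, comp_pair R j p l q, comp_pair R j p k q, comp_pair R i p l q]
      ring
    simp only [h]
    congr 1
    exact Finset.sum_congr rfl fun p _ => Finset.sum_congr rfl fun q _ => mul_comm _ _
  · let B : ι → ι → ι → ι → ℝ := fun a b c d => ∑ p, ∑ q, comp R a p b q * comp R c p d q
    have hB : ∀ a b c d, B a b c d = B b a d c := by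
      intro a b c d
      simp only [B]
      rw [Finset.sum_comm]
      refine Finset.sum_congr rfl fun p _ => Finset.sum_congr rfl fun q _ => ?_
      rw [comp_pair R b p a q, comp_pair R d p c q]
    have hC : ∀ a b c d, B a b c d = B c d a b := fun a b c d =>
      Finset.sum_congr rfl fun p _ => Finset.sum_congr rfl fun q _ => mul_comm _ _
    have hs : ∀ a b c d, sharpTerm R a b c d = 2 * B a c b d - 2 * B a d b c := by
      intro a b c d
      simp only [sharpTerm, B, Finset.mul_sum, ← Finset.sum_sub_distrib]
      refine Finset.sum_congr rfl fun p _ => Finset.sum_congr rfl fun q _ => ?_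
      ring
    have hd : ∀ a b p q, comp R a b p q = comp R a p b q - comp R a q b p := by
      intro a b p q
      have h1 := comp_bianchi R a b p q
      have h2 : comp R a p q b = -comp R a p b q := by
        rw [← comp_pair R a p q b, comp_swap R, comp_pair R a p b q]
      linarith
    have hq : ∀ a b c d, sqTerm R a b c d = 2 * B a b c d - 2 * B a b d c := by
      intro a b c d
      have e1 : sqTerm R a b c d = (B a b c d - B a b d c)
          + (∑ p, ∑ q, comp R a q b p * comp R c q d p
            - ∑ p, ∑ q, comp R a q b p * comp R d q c p) := by
        simp only [sqTerm, B, ← Finset.sum_sub_distrib, ← Finset.sum_add_distrib]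
        refine Finset.sum_congr rfl fun p _ => Finset.sum_congr rfl fun q _ => ?_
        rw [hd a b p q, hd c d p q, comp_pair R c q d p, comp_pair R c p d q]
        ring
      have e2 : ∑ p, ∑ q, comp R a q b p * comp R c q d p = B a b c d := Finset.sum_comm
      have e3 : ∑ p, ∑ q, comp R a q b p * comp R d q c p = B a b d c := Finset.sum_comm
      rw [e1, e2, e3]; ring
    simp only [hs, hq]
    linarith [hB i j k l, hB i j l k, hB i k l j, hB i k j l, hB i l j k, hB i l k j,
      hC i j k l, hC i j l k, hC i k l j, hC i k j l, hC i l j k, hC i l k j,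
      hC j i l k, hC j i k l, hC k i j l, hC k i l j, hC l i k j, hC l i j k]

/-- Hamilton's quadratic map `Q(R) = R² + R^#`. -/
def Q {ι : Type*} [Fintype ι] (R : AlgCurv ι) : AlgCurv ι :=
  ⟨fun i j k l => sqTerm R i j k l + sharpTerm R i j k l, Q_symmetries R⟩

/-- Nonnegative isotropic curvature, tested on all orthonormal four-frames
`e 0, e 1, e 2, e 3` (written `e₁, e₂, e₃, e₄` in the usual numbering). -/
def NonnegIsotropic {ι : Type*} [Fintype ι] (R : AlgCurv ι) : Prop :=
  ∀ e : Fin 4 → EuclideanSpace ℝ ι, Orthonormal ℝ e →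
    0 ≤ eval R (e 0) (e 2) (e 0) (e 2) + eval R (e 0) (e 3) (e 0) (e 3)
      + eval R (e 1) (e 2) (e 1) (e 2) + eval R (e 1) (e 3) (e 1) (e 3)
      - 2 * eval R (e 0) (e 1) (e 2) (e 3)

/-- The `ℝⁿ`-part of a vector of `ℝⁿ × ℝ²`, the latter being the Euclidean space with index
type `Fin n ⊕ Fin 2`. -/
def fstPart {n : ℕ} (v : EuclideanSpace ℝ (Fin n ⊕ Fin 2)) : EuclideanSpace ℝ (Fin n) :=
  WithLp.toLp 2 fun i => v (Sum.inl i)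

/-- The `ℝ²`-part of a vector of `ℝⁿ × ℝ²`. -/
def sndPart {n : ℕ} (v : EuclideanSpace ℝ (Fin n ⊕ Fin 2)) : EuclideanSpace ℝ (Fin 2) :=
  WithLp.toLp 2 fun i => v (Sum.inr i)

/-- The four-linear form
`R(v₁,v₂,v₃,v₄) + ⟨x₁,x₃⟩⟨x₂,x₄⟩ - ⟨x₁,x₄⟩⟨x₂,x₃⟩` on `ℝⁿ × ℝ²`, where `wⱼ = (vⱼ, xⱼ)`. -/
noncomputable def productForm {n : ℕ} (R : AlgCurv (Fin n))
    (w₁ w₂ w₃ w₄ : EuclideanSpace ℝ (Fin n ⊕ Fin 2)) : ℝ :=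
  eval R (fstPart w₁) (fstPart w₂) (fstPart w₃) (fstPart w₄)
    + inner ℝ (sndPart w₁) (sndPart w₃) * inner ℝ (sndPart w₂) (sndPart w₄)
    - inner ℝ (sndPart w₁) (sndPart w₄) * inner ℝ (sndPart w₂) (sndPart w₃)

theorem eval_swap {ι : Type*} [Fintype ι] (R : AlgCurv ι) (a b c d : EuclideanSpace ℝ ι) :
    eval R b a c d = -eval R a b c d := by
  unfold eval
  rw [Finset.sum_comm]
  simp only [← Finset.sum_neg_distrib]
  refine Finset.sum_congr rfl fun i _ => Finset.sum_congr rfl fun j _ =>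
    Finset.sum_congr rfl fun k _ => Finset.sum_congr rfl fun l _ => ?_
  rw [comp_swap R i j k l]; ring

theorem eval_pair {ι : Type*} [Fintype ι] (R : AlgCurv ι) (a b c d : EuclideanSpace ℝ ι) :
    eval R c d a b = eval R a b c d := by
  have key : ∀ f : ι → ι → ι → ι → ℝ,
      ∑ i, ∑ j, ∑ k, ∑ l, f i j k l = ∑ k, ∑ l, ∑ i, ∑ j, f i j k l := by
    intro f
    have h1 : ∀ i, ∑ j, ∑ k, ∑ l, f i j k l = ∑ k, ∑ l, ∑ j, f i j k l := fun i => by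
      rw [Finset.sum_comm]
      exact Finset.sum_congr rfl fun k _ => Finset.sum_comm
    simp only [h1]
    rw [Finset.sum_comm]
    exact Finset.sum_congr rfl fun k _ => Finset.sum_comm
  unfold eval
  rw [key]
  refine Finset.sum_congr rfl fun i _ => Finset.sum_congr rfl fun j _ =>
    Finset.sum_congr rfl fun k _ => Finset.sum_congr rfl fun l _ => ?_
  rw [comp_pair R i j k l]; ring

theorem eval_bianchi {ι : Type*} [Fintype ι] (R : AlgCurv ι) (a b c d : EuclideanSpace ℝ ι) :
    eval R a b c d + eval R a c d b + eval R a d b c = 0 := by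
  have key : ∀ f : ι → ι → ι → ℝ, ∑ j, ∑ k, ∑ l, f j k l = ∑ k, ∑ l, ∑ j, f j k l := by
    intro f
    rw [Finset.sum_comm]
    exact Finset.sum_congr rfl fun k _ => Finset.sum_comm
  have h2 : eval R a c d b = ∑ i, ∑ j, ∑ k, ∑ l, comp R i k l j * a i * c k * d l * b j := by
    unfold eval
    exact Finset.sum_congr rfl fun i _ => (key _).symm
  have h3 : eval R a d b c = ∑ i, ∑ j, ∑ k, ∑ l, comp R i l j k * a i * d l * b j * c k := by
    unfold eval
    exact Finset.sum_congr rfl fun i _ => key _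
  rw [h2, h3]
  simp only [eval, ← Finset.sum_add_distrib]
  refine Finset.sum_eq_zero fun i _ => Finset.sum_eq_zero fun j _ =>
    Finset.sum_eq_zero fun k _ => Finset.sum_eq_zero fun l _ => ?_
  linear_combination (a i * b j * c k * d l) * comp_bianchi R i j k l

/-- The induced algebraic curvature operator `S` on `ℝⁿ × ℝ²` (that of `M × S²(1)`), with
components the values of `productForm` on the standard basis. -/
noncomputable def induced {n : ℕ} (R : AlgCurv (Fin n)) : AlgCurv (Fin n ⊕ Fin 2) :=
  ⟨fun a b c d => productForm R (EuclideanSpace.single a 1) (EuclideanSpace.single b 1)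
      (EuclideanSpace.single c 1) (EuclideanSpace.single d 1), by
    refine ⟨fun i j k l => ?_, fun i j k l => ?_, fun i j k l => ?_⟩ <;>
      simp only [productForm]
    · rw [eval_swap R (fstPart (EuclideanSpace.single i 1))]; ring
    · rw [eval_pair R (fstPart (EuclideanSpace.single i 1))]
      simp only [real_inner_comm]
      simp only [real_inner_comm (sndPart (EuclideanSpace.single k 1)),
        real_inner_comm (sndPart (EuclideanSpace.single l 1))]
      ring
    · have h := eval_bianchi R (fstPart (EuclideanSpace.single i 1))
        (fstPart (EuclideanSpace.single j 1)) (fstPart (EuclideanSpace.single k 1))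
        (fstPart (EuclideanSpace.single l 1))
      rw [real_inner_comm (sndPart (EuclideanSpace.single l 1))
          (sndPart (EuclideanSpace.single j 1)),
        real_inner_comm (sndPart (EuclideanSpace.single k 1))
          (sndPart (EuclideanSpace.single j 1)),
        real_inner_comm (sndPart (EuclideanSpace.single l 1))
          (sndPart (EuclideanSpace.single k 1))]
      linarith⟩

theorem eval_single {ι : Type*} [Fintype ι] [DecidableEq ι] (R : AlgCurv ι) (i j k l : ι) :
    eval R (EuclideanSpace.single i 1) (EuclideanSpace.single j 1)
      (EuclideanSpace.single k 1) (EuclideanSpace.single l 1) = comp R i j k l := by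
  simp [eval]

theorem fstPart_single_inl {n : ℕ} (i : Fin n) :
    fstPart (EuclideanSpace.single (Sum.inl i) (1 : ℝ)) = EuclideanSpace.single i 1 := by
  ext j; simp [fstPart]

theorem fstPart_single_inr {n : ℕ} (i : Fin 2) :
    fstPart (n := n) (EuclideanSpace.single (Sum.inr i) (1 : ℝ)) = 0 := by
  ext j; simp [fstPart]

theorem sndPart_single_inr {n : ℕ} (i : Fin 2) :
    sndPart (n := n) (EuclideanSpace.single (Sum.inr i) (1 : ℝ)) = EuclideanSpace.single i 1 := by
  ext j; simp [sndPart]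

theorem sndPart_single_inl {n : ℕ} (i : Fin n) :
    sndPart (EuclideanSpace.single (Sum.inl i) (1 : ℝ)) = 0 := by
  ext j; simp [sndPart]

theorem comp_induced {n : ℕ} (R : AlgCurv (Fin n)) (a b c d : Fin n ⊕ Fin 2) :
    comp (induced R) a b c d = productForm R (EuclideanSpace.single a 1)
      (EuclideanSpace.single b 1) (EuclideanSpace.single c 1) (EuclideanSpace.single d 1) := rfl

/-- The defining formula of the induced operator holds on all vectors of `ℝⁿ × ℝ²`. -/
theorem eval_induced {n : ℕ} (R : AlgCurv (Fin n))
    (w₁ w₂ w₃ w₄ : EuclideanSpace ℝ (Fin n ⊕ Fin 2)) :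
    eval (induced R) w₁ w₂ w₃ w₄ = productForm R w₁ w₂ w₃ w₄ := by
  have e0 : ∀ a b c d : EuclideanSpace ℝ (Fin n), a = 0 ∨ b = 0 ∨ c = 0 ∨ d = 0 →
      eval R a b c d = 0 := by
    rintro a b c d (h | h | h | h) <;> simp [eval, h]
  unfold eval
  simp only [comp_induced, productForm, Fintype.sum_sum_type, fstPart_single_inl,
    fstPart_single_inr, sndPart_single_inl, sndPart_single_inr, eval_single, inner_zero_left,
    inner_zero_right, e0, true_or, or_true, mul_zero, zero_mul, add_zero, zero_add, sub_zero,
    Finset.sum_const_zero, sub_self, Finset.sum_add_distrib]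
  simp [eval, fstPart, sndPart, Fin.sum_univ_two, PiLp.inner_apply]
  ring

/-- The set `E` of algebraic curvature operators `R` on `ℝⁿ` whose induced operator on
`ℝⁿ × ℝ²` has nonnegative isotropic curvature. -/
def E (n : ℕ) : Set (AlgCurv (Fin n)) := {R | NonnegIsotropic (induced R)}

end AlgCurv

/-! Work with complex vectors z, w and the bivector φ = z ∧ w. An operator R lies in `E` exactly
when R(z, w, z̄, w̄) + |(z·z)(w·w) - (z·w)²| ≥ 0 for all z, w in ℂⁿ (`mem_E_iff`). Indeed z, w
become totally isotropic in ℂⁿ × ℂ² once ℂ²-components with the opposite Gram matrix are added, and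
the sphere factor contributes the modulus of the Gram determinant of these components, which is that
of z, w. The gain is that this extra term is invariant under the complex orthogonal group.

Suppose this function is nonnegative and vanishes at (z, w). Moving z, w along exp(sY), with Y
complex antisymmetric, gives a second-derivative inequality. Adding those for Y and iY cancels the
acceleration and leaves R ≥ 0 on the velocity of φ (`second_variation`). So R is nonnegative on the
ranges of ad φ and of its adjoint, whence tr(ad φ · R · (ad φ)ᴴ · R) ≥ 0; this trace is R^#(φ, φ̄)
(`trace_adMatrix`). Since R²(φ, φ̄) is a sum of squares, Q(R)(φ, φ̄) ≥ 0 at every zero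
(`reForm_Q_nonneg`).

This inequality is not strict, so R(t) is perturbed by ε exp((L+1)t) times the operator of constant
curvature one. On the compact set of unitary pairs, a first zero would have positive time
derivative, which is impossible (`isoForm_add_exp_smul_constCurv_pos`). Then ε tends to 0. -/

open scoped Matrix

/-! ### Sesquilinear forms and the trace inequality -/

/-- The real part of the sesquilinear extension of the real bilinear form with matrix `T`. -/
def reForm {κ : Type*} [Fintype κ] (T : Matrix κ κ ℝ) (x y : κ → ℂ) : ℝ :=
  ∑ p, ∑ q, T p q * (x p * star (y q)).re

section ReForm

variable {κ : Type*} [Fintype κ] (T : Matrix κ κ ℝ)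

theorem reForm_add_left (x x' y : κ → ℂ) :
    reForm T (x + x') y = reForm T x y + reForm T x' y := by
  simp only [reForm, Pi.add_apply, add_mul, Complex.add_re, mul_add, Finset.sum_add_distrib]

theorem reForm_add_right (x y y' : κ → ℂ) :
    reForm T x (y + y') = reForm T x y + reForm T x y' := by
  simp only [reForm, Pi.add_apply, star_add, mul_add, Complex.add_re, Finset.sum_add_distrib]

theorem reForm_neg_left (x y : κ → ℂ) : reForm T (-x) y = -reForm T x y := by
  simp only [reForm, Pi.neg_apply, neg_mul, mul_neg, Complex.neg_re, Finset.sum_neg_distrib]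

theorem reForm_neg_right (x y : κ → ℂ) : reForm T x (-y) = -reForm T x y := by
  simp only [reForm, Pi.neg_apply, star_neg, mul_neg, Complex.neg_re, Finset.sum_neg_distrib]

theorem reForm_smul_smul (c : ℂ) (x y : κ → ℂ) :
    reForm T (c • x) (c • y) = Complex.normSq c * reForm T x y := by
  simp only [reForm, Finset.mul_sum, Pi.smul_apply, smul_eq_mul]
  refine Finset.sum_congr rfl fun p _ => Finset.sum_congr rfl fun q _ => ?_
  simp [Complex.normSq_apply]
  ring

theorem reForm_zero_left (y : κ → ℂ) : reForm T 0 y = 0 := by simp [reForm]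

theorem reForm_symm (hT : ∀ p q, T p q = T q p) (x y : κ → ℂ) :
    reForm T x y = reForm T y x := by
  unfold reForm
  rw [Finset.sum_comm]
  refine Finset.sum_congr rfl fun p _ => Finset.sum_congr rfl fun q _ => ?_
  rw [hT q p]
  simp only [Complex.mul_re, Complex.star_def, Complex.conj_re, Complex.conj_im]
  ring

theorem reForm_star (x y : κ → ℂ) : reForm T (star x) (star y) = reForm T x y := by
  simp [reForm]

theorem reForm_add_matrix (T' : Matrix κ κ ℝ) (x y : κ → ℂ) :
    reForm (T + T') x y = reForm T x y + reForm T' x y := by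
  simp only [reForm, Matrix.add_apply, add_mul, Finset.sum_add_distrib]

theorem reForm_smul_matrix (c : ℝ) (x y : κ → ℂ) :
    reForm (c • T) x y = c * reForm T x y := by
  simp only [reForm, Matrix.smul_apply, smul_eq_mul, mul_assoc, Finset.mul_sum]

theorem hasDerivAt_reForm {x y : ℝ → κ → ℂ} {x' y' : κ → ℂ} {s : ℝ}
    (hx : HasDerivAt x x' s) (hy : HasDerivAt y y' s) :
    HasDerivAt (fun s => reForm T (x s) (y s)) (reForm T x' (y s) + reForm T (x s) y') s := by
  unfold reForm
  simp only [← Finset.sum_add_distrib]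
  refine HasDerivAt.fun_sum fun p _ => HasDerivAt.fun_sum fun q _ => ?_
  have h1 := hasDerivAt_pi.1 hx p
  have h2 := (hasDerivAt_pi.1 hy q).star
  have h3 := (Complex.reCLM.hasFDerivAt.comp_hasDerivAt s (h1.mul h2)).const_mul (T p q)
  simpa [mul_add] using h3

theorem continuousOn_reForm {X : Type*} [TopologicalSpace X] {s : Set X}
    {A : X → Matrix κ κ ℝ} {x y : X → κ → ℂ} (hA : ContinuousOn A s) (hx : ContinuousOn x s)
    (hy : ContinuousOn y s) : ContinuousOn (fun a => reForm (A a) (x a) (y a)) s := by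
  unfold reForm
  refine continuousOn_finsetSum _ fun p _ => continuousOn_finsetSum _ fun q _ => ?_
  have h : ContinuousOn (fun a => A a p q) s := (continuous_apply_apply p q).comp_continuousOn hA
  exact h.mul (Complex.continuous_re.comp_continuousOn
    ((continuousOn_pi.1 hx p).mul (continuousOn_pi.1 hy q).star))

theorem re_star_dotProduct_mulVec (hT : ∀ p q, T p q = T q p) (x y : κ → ℂ) :
    (star x ⬝ᵥ (T.map Complex.ofReal) *ᵥ y).re = reForm T x y := by
  rw [reForm_symm T hT]
  simp only [dotProduct, Matrix.mulVec, Finset.mul_sum, Complex.re_sum, reForm]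
  rw [Finset.sum_comm]
  refine Finset.sum_congr rfl fun p _ => Finset.sum_congr rfl fun q _ => ?_
  rw [hT p q]
  simp
  ring

/-- If a real symmetric `T` is nonnegative on the ranges of `D` and `Dᴴ`, then
`tr (D T Dᴴ T) ≥ 0`. -/
theorem re_trace_mul_mul_conjTranspose_mul_nonneg [DecidableEq κ] (hT : ∀ p q, T p q = T q p)
    (D : Matrix κ κ ℂ) (h₁ : ∀ x, 0 ≤ reForm T (D *ᵥ x) (D *ᵥ x))
    (h₂ : ∀ x, 0 ≤ reForm T (Dᴴ *ᵥ x) (Dᴴ *ᵥ x)) :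
    0 ≤ (D * T.map Complex.ofReal * Dᴴ * T.map Complex.ofReal).trace.re := by
  set M : Matrix κ κ ℂ := T.map Complex.ofReal with hM
  have hMh : Mᴴ = M := by
    ext p q
    simp [hM, hT p q]
  have hN : (D * M * Dᴴ).IsHermitian := by
    simp [Matrix.IsHermitian, Matrix.conjTranspose_mul, hMh, Matrix.mul_assoc]
  set N := D * M * Dᴴ with hNdef
  have htr : (N * M).trace
      = ∑ a, (hN.eigenvalues a : ℂ) * (star (hN.eigenvectorBasis a).ofLp ⬝ᵥ
          M *ᵥ (hN.eigenvectorBasis a).ofLp) := by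
    have hs := hN.spectral_theorem
    rw [Unitary.conjStarAlgAut_apply] at hs
    conv_lhs => rw [hs]
    rw [Matrix.mul_assoc, Matrix.mul_assoc, Matrix.trace_mul_comm, Matrix.mul_assoc]
    simp only [Matrix.trace, Matrix.diag_apply, Matrix.diagonal_mul]
    refine Finset.sum_congr rfl fun a _ => ?_
    congr 1
    simp only [Matrix.mul_apply, dotProduct, Matrix.mulVec, Finset.mul_sum, Finset.sum_mul]
    rw [Finset.sum_comm]
    simp [Matrix.star_apply, mul_assoc]
  rw [htr, Complex.re_sum]
  refine Finset.sum_nonneg fun a _ => ?_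
  set v := (hN.eigenvectorBasis a).ofLp with hv
  rw [Complex.re_ofReal_mul, re_star_dotProduct_mulVec T hT]
  -- The eigenvalue is ⟨v, D T Dᴴ v⟩, the value of T at Dᴴ v.
  have hpos : 0 ≤ hN.eigenvalues a := by
    rw [hN.eigenvalues_eq a, ← hv, hNdef, ← Matrix.mulVec_mulVec, ← Matrix.mulVec_mulVec,
      Matrix.dotProduct_mulVec]
    have h := h₂ v
    rw [← re_star_dotProduct_mulVec T hT, Matrix.star_mulVec, Matrix.conjTranspose_conjTranspose]
      at h
    exact h
  rcases hpos.eq_or_lt with h0 | h0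
  · simp [← h0]
  refine mul_nonneg hpos ?_
  -- An eigenvector of D T Dᴴ with nonzero eigenvalue lies in the range of D, where T is
  -- nonnegative.
  have hv' : v = D *ᵥ ((hN.eigenvalues a : ℂ)⁻¹ • (M *ᵥ (Dᴴ *ᵥ v))) := by
    have h := hN.mulVec_eigenvectorBasis a
    rw [← hv] at h
    rw [Matrix.mulVec_smul, Matrix.mulVec_mulVec, Matrix.mulVec_mulVec,
      ← hNdef, h, ← Complex.coe_smul, smul_smul, inv_mul_cancel₀, one_smul]
    exact_mod_cast h0.ne'
  rw [hv']
  exact h₁ _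

end ReForm

/-! ### Second-derivative test, bivectors and the adjoint action -/

/-- The second derivative is nonnegative at a minimum. -/
theorem second_deriv_nonneg_of_min {f f' : ℝ → ℝ} {c : ℝ} (hf : ∀ s, HasDerivAt f (f' s) s)
    (hf' : HasDerivAt f' c 0) (hmin : ∀ s, f 0 ≤ f s) : 0 ≤ c := by
  by_contra! hc
  have hd : deriv f = f' := funext fun s => (hf s).deriv
  have hlm : IsLocalMin f 0 := Filter.Eventually.of_forall hmin
  have hmax : IsLocalMax f 0 := by
    apply isLocalMax_of_deriv_deriv_neg
    · rw [hd, hf'.deriv]; exact hc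
    · exact hlm.deriv_eq_zero
    · exact (hf 0).continuousAt
  -- A point that is both a local minimum and a local maximum makes f locally constant, which forces
  -- c = 0.
  have heq : f =ᶠ[nhds 0] fun _ => f 0 := hmax.mono fun s hs => le_antisymm hs (hmin s)
  have h2 : deriv (deriv f) 0 = 0 := by
    rw [heq.deriv.deriv_eq]
    simp
  rw [hd, hf'.deriv] at h2
  exact hc.ne h2

/-- The bivector `z ∧ w`, as a function of a pair of indices. -/
def biv {ι : Type*} (z w : ι → ℂ) : ι × ι → ℂ := fun p => z p.1 * w p.2 - z p.2 * w p.1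

/-- The determinant of the bilinear Gram matrix of two complex vectors. -/
def gramDet {ι : Type*} [Fintype ι] (z w : ι → ℂ) : ℂ := (z ⬝ᵥ z) * (w ⬝ᵥ w) - (z ⬝ᵥ w) ^ 2

/-- The map `x ↦ φ x + x φᵀ` on matrices, as a matrix indexed by pairs. For antisymmetric `φ`
this is the commutator with `φ`. -/
def adMatrix {ι : Type*} [DecidableEq ι] (φ : ι × ι → ℂ) : Matrix (ι × ι) (ι × ι) ℂ :=
  fun p q => φ (p.1, q.1) * (if p.2 = q.2 then 1 else 0)
    + (if p.1 = q.1 then 1 else 0) * φ (p.2, q.2)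

theorem sum_sum_comm {α β γ δ M : Type*} [Fintype α] [Fintype β] [Fintype γ] [Fintype δ]
    [AddCommMonoid M] (f : α → β → γ → δ → M) :
    ∑ a, ∑ b, ∑ c, ∑ d, f a b c d = ∑ c, ∑ d, ∑ a, ∑ b, f a b c d := by
  have h1 : ∀ a, ∑ b, ∑ c, ∑ d, f a b c d = ∑ c, ∑ d, ∑ b, f a b c d := fun a => by
    rw [Finset.sum_comm]
    exact Finset.sum_congr rfl fun c _ => Finset.sum_comm
  simp only [h1]
  rw [Finset.sum_comm]
  exact Finset.sum_congr rfl fun c _ => Finset.sum_comm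

theorem biv_smul_left {ι : Type*} (c : ℂ) (z w : ι → ℂ) : biv (c • z) w = c • biv z w := by
  ext p; simp [biv]; ring

theorem biv_smul_right {ι : Type*} (c : ℂ) (z w : ι → ℂ) : biv z (c • w) = c • biv z w := by
  ext p; simp [biv]; ring

theorem biv_add_right {ι : Type*} (z w w' : ι → ℂ) : biv z (w + w') = biv z w + biv z w' := by
  ext p; simp [biv]; ring

theorem biv_neg_left {ι : Type*} (z w : ι → ℂ) : biv (-z) w = -biv z w := by
  ext p; simp [biv]; ring

theorem biv_neg_right {ι : Type*} (z w : ι → ℂ) : biv z (-w) = -biv z w := by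
  ext p; simp [biv]; ring

theorem biv_swap {ι : Type*} (z w : ι → ℂ) (i j : ι) : biv z w (j, i) = -biv z w (i, j) := by
  simp [biv]

theorem adMatrix_mulVec {ι : Type*} [Fintype ι] [DecidableEq ι] (φ x : ι × ι → ℂ) (i p : ι) :
    (adMatrix φ *ᵥ x) (i, p) = ∑ j, φ (i, j) * x (j, p) + ∑ q, φ (p, q) * x (i, q) := by
  simp [Matrix.mulVec, dotProduct, adMatrix, Fintype.sum_prod_type, add_mul,
    Finset.sum_add_distrib]

/-- Because of this identity and the reality of R, nonnegativity on the range of ad φ passes to the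
range of its adjoint. -/
theorem adMatrix_conjTranspose_mulVec {ι : Type*} [Fintype ι] [DecidableEq ι] (φ : ι × ι → ℂ)
    (hφ : ∀ i j, φ (j, i) = -φ (i, j)) (x : ι × ι → ℂ) :
    (adMatrix φ)ᴴ *ᵥ x = -star (adMatrix φ *ᵥ star x) := by
  ext ⟨i, p⟩
  rw [Pi.neg_apply, Pi.star_apply, adMatrix_mulVec]
  have h : ∀ q : ι × ι, (adMatrix φ)ᴴ (i, p) q
      = -((if p = q.2 then 1 else 0) * star (φ (i, q.1))
        + (if i = q.1 then 1 else 0) * star (φ (p, q.2))) := fun ⟨j, q⟩ => by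
    rw [Matrix.conjTranspose_apply, adMatrix]
    simp only [hφ i j, hφ p q, eq_comm (a := q), eq_comm (a := j)]
    split_ifs <;> simp [add_comm]
  simp only [Matrix.mulVec, dotProduct, h, Fintype.sum_prod_type]
  simp [add_mul, Finset.sum_add_distrib]

/-- Links algebra to variation: up to its symmetric part, ad φ applied to x is the velocity of z ∧ w
under the antisymmetric generator Y = xᵀ - x. -/
theorem adMatrix_biv_mulVec {ι : Type*} [Fintype ι] [DecidableEq ι] (z w : ι → ℂ)
    (x : ι × ι → ℂ) (i p : ι) :
    (adMatrix (biv z w) *ᵥ x) (i, p) - (adMatrix (biv z w) *ᵥ x) (p, i)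
      = (biv ((Matrix.of fun a b => x (b, a) - x (a, b)) *ᵥ z) w
          + biv z ((Matrix.of fun a b => x (b, a) - x (a, b)) *ᵥ w)) (i, p) := by
  rw [adMatrix_mulVec, adMatrix_mulVec]
  simp only [Pi.add_apply, biv, Matrix.mulVec, dotProduct, Matrix.of_apply,
    Finset.sum_mul, Finset.mul_sum]
  simp only [← Finset.sum_add_distrib, ← Finset.sum_sub_distrib]
  refine Finset.sum_congr rfl fun j _ => ?_
  ring

/-! ### The quadratic terms of Q as forms on bivectors -/

namespace AlgCurv

/-- The matrix of a curvature operator as a bilinear form on pairs of indices. -/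
def curvMatrix {ι : Type*} (R : AlgCurv ι) : Matrix (ι × ι) (ι × ι) ℝ :=
  fun p q => comp R p.1 p.2 q.1 q.2

theorem curvMatrix_symm {ι : Type*} (R : AlgCurv ι) (p q : ι × ι) :
    curvMatrix R p q = curvMatrix R q p := comp_pair R _ _ _ _

theorem comp_swap_right {ι : Type*} (R : AlgCurv ι) (i j k l : ι) :
    comp R i j l k = -comp R i j k l := by
  rw [← comp_pair R i j l k, comp_swap, comp_pair]

variable {ι : Type*} [Fintype ι]

theorem reForm_swap_left (R : AlgCurv ι) (x y : ι × ι → ℂ) :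
    reForm (curvMatrix R) (fun p => x (p.2, p.1)) y = -reForm (curvMatrix R) x y := by
  simp only [reForm, Fintype.sum_prod_type]
  rw [Finset.sum_comm]
  simp only [← Finset.sum_neg_distrib]
  refine Finset.sum_congr rfl fun i _ => Finset.sum_congr rfl fun j _ =>
    Finset.sum_congr rfl fun k _ => Finset.sum_congr rfl fun l _ => ?_
  simp only [curvMatrix]
  rw [comp_swap R i j]
  ring

/-- A curvature operator sees only the antisymmetric part of its argument, and y is twice that part
of x. -/
theorem four_mul_reForm_self (R : AlgCurv ι) (x y : ι × ι → ℂ)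
    (hy : ∀ i j, x (i, j) - x (j, i) = y (i, j)) :
    4 * reForm (curvMatrix R) x x = reForm (curvMatrix R) y y := by
  have hy' : y = x + -(fun p => x (p.2, p.1)) := by
    ext ⟨i, j⟩
    simp [← hy, sub_eq_add_neg]
  have hs : ∀ u v, reForm (curvMatrix R) u (fun p => v (p.2, p.1))
      = -reForm (curvMatrix R) u v := fun u v => by
    rw [reForm_symm _ (curvMatrix_symm R), reForm_swap_left, reForm_symm _ (curvMatrix_symm R)]
  simp only [hy', reForm_add_left, reForm_add_right, reForm_neg_left, reForm_neg_right,
    reForm_swap_left, hs]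
  ring

/-- With A = φ ⊗ 1 and P the swap of the two indices, ad φ = A + PAP. The antisymmetries of R reduce
the trace to 4 tr(A M Aᴴ M), while the antisymmetry of φ merges the two halves of R^# into the same
sum. -/
theorem trace_adMatrix [DecidableEq ι] (R : AlgCurv ι) (φ : ι × ι → ℂ)
    (hφ : ∀ i j, φ (j, i) = -φ (i, j)) :
    (adMatrix φ * (curvMatrix R).map Complex.ofReal * (adMatrix φ)ᴴ
      * (curvMatrix R).map Complex.ofReal).trace.re
      = reForm (fun p q => sharpTerm R p.1 p.2 q.1 q.2) φ φ := by
  set M := (curvMatrix R).map Complex.ofReal with hM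
  let P : Matrix (ι × ι) (ι × ι) ℂ :=
    Matrix.of fun p q => (if p.1 = q.2 then 1 else 0) * (if p.2 = q.1 then 1 else 0)
  let A : Matrix (ι × ι) (ι × ι) ℂ :=
    Matrix.of fun p q => φ (p.1, q.1) * (if p.2 = q.2 then 1 else 0)
  have hPM : P * M = -M := by
    ext ⟨i, j⟩ ⟨k, l⟩
    simp [Matrix.mul_apply, P, hM, curvMatrix, Fintype.sum_prod_type, comp_swap R i j]
  have hMP : M * P = -M := by
    ext ⟨i, j⟩ ⟨k, l⟩
    simp [Matrix.mul_apply, P, hM, curvMatrix, Fintype.sum_prod_type, comp_swap_right R i j k l]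
  have hPP : Pᴴ = P := by
    ext ⟨i, j⟩ ⟨k, l⟩
    simp only [P, Matrix.conjTranspose_apply, Matrix.of_apply, eq_comm (a := k), eq_comm (a := l)]
    split_ifs <;> simp
  have hD : adMatrix φ = A + P * A * P := by
    ext ⟨i, j⟩ ⟨k, l⟩
    simp [Matrix.mul_apply, P, A, adMatrix, Fintype.sum_prod_type]
  have hX : (A * M * Aᴴ * M).trace.re = ∑ i, ∑ j, ∑ k, ∑ l, ∑ p, ∑ q,
      comp R i p k q * comp R j p l q * (φ (i, j) * star (φ (k, l))).re := by
    have hAM : ∀ i p l q, (A * M) (i, p) (l, q)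
        = ∑ j, φ (i, j) * (comp R j p l q : ℂ) := fun i p l q => by
      simp [Matrix.mul_apply, A, hM, curvMatrix, Fintype.sum_prod_type]
    have hAMA : ∀ i p k q, (A * M * Aᴴ) (i, p) (k, q)
        = ∑ l, ∑ j, φ (i, j) * (comp R j p l q : ℂ) * star (φ (k, l)) := fun i p k q => by
      rw [Matrix.mul_apply, Fintype.sum_prod_type]
      simp only [hAM, Finset.sum_mul, Matrix.conjTranspose_apply, A, Matrix.of_apply]
      refine Finset.sum_congr rfl fun l _ => ?_
      rw [Finset.sum_eq_single q]
      · simp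
      · intro b _ hb
        simp [hb.symm]
      · simp
    have hre : (A * M * Aᴴ * M).trace.re = ∑ i, ∑ p, ∑ k, ∑ q, ∑ l, ∑ j,
        comp R i p k q * comp R j p l q * (φ (i, j) * star (φ (k, l))).re := by
      simp only [Matrix.trace, Matrix.diag_apply, Matrix.mul_apply (M := A * M * Aᴴ),
        Fintype.sum_prod_type, hAMA, Complex.re_sum, Finset.sum_mul]
      refine Finset.sum_congr rfl fun i _ => Finset.sum_congr rfl fun p _ =>
        Finset.sum_congr rfl fun k _ => Finset.sum_congr rfl fun q _ =>
        Finset.sum_congr rfl fun l _ => Finset.sum_congr rfl fun j _ => ?_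
      simp only [hM, Matrix.map_apply, curvMatrix, comp_pair R i p k q]
      rw [Complex.re_mul_ofReal, mul_right_comm, Complex.re_mul_ofReal]
      ring
    rw [hre]
    refine Finset.sum_congr rfl fun i _ => ?_
    rw [Finset.sum_comm, Finset.sum_congr rfl fun k _ => sum_sum_comm _,
      Finset.sum_congr rfl fun k _ => Finset.sum_comm, Finset.sum_comm]
  -- Follows from PM = MP = -M, P being Hermitian. The P-term has opposite trace to the other one,
  -- hence the factor 4 below.
  have hDX : adMatrix φ * M * (adMatrix φ)ᴴ * M
      = (2 : ℂ) • (A * M * Aᴴ * M) - (2 : ℂ) • (P * (A * M * Aᴴ * M)) := by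
    have e1 : adMatrix φ * M = A * M - P * (A * M) := by
      rw [hD, Matrix.add_mul, Matrix.mul_assoc (P * A), hPM]
      simp [Matrix.mul_assoc, sub_eq_add_neg]
    have e2 : (adMatrix φ)ᴴ * M = Aᴴ * M - P * (Aᴴ * M) := by
      rw [hD, Matrix.conjTranspose_add, Matrix.conjTranspose_mul, Matrix.conjTranspose_mul, hPP,
        Matrix.add_mul, Matrix.mul_assoc P, Matrix.mul_assoc _ P, hPM]
      simp [sub_eq_add_neg]
    have e3 : A * M * P = -(A * M) := by rw [Matrix.mul_assoc, hMP, Matrix.mul_neg]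
    rw [Matrix.mul_assoc, e2, e1, Matrix.mul_sub, Matrix.sub_mul, Matrix.sub_mul,
      ← Matrix.mul_assoc (A * M) P, e3, Matrix.mul_assoc P (A * M) (P * _),
      ← Matrix.mul_assoc (A * M) P, e3]
    simp only [Matrix.mul_assoc, Matrix.neg_mul, Matrix.mul_neg, two_smul]
    abel
  rw [hDX, Matrix.trace_sub, Matrix.trace_smul, Matrix.trace_smul, Matrix.trace_mul_comm P,
    Matrix.mul_assoc _ M P, hMP, Matrix.mul_neg, Matrix.trace_neg]
  have h4 : ∀ c : ℂ, ((2 : ℂ) • c - (2 : ℂ) • (-c)).re = 4 * c.re := fun c => by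
    simp; ring
  rw [h4, hX]
  have hsw : ∑ i, ∑ j, ∑ k, ∑ l, ∑ p, ∑ q,
      comp R i p l q * comp R j p k q * (φ (i, j) * star (φ (k, l))).re
      = -∑ i, ∑ j, ∑ k, ∑ l, ∑ p, ∑ q,
      comp R i p k q * comp R j p l q * (φ (i, j) * star (φ (k, l))).re := by
    simp only [← Finset.sum_neg_distrib]
    refine Finset.sum_congr rfl fun i _ => Finset.sum_congr rfl fun j _ => ?_
    rw [Finset.sum_comm]
    refine Finset.sum_congr rfl fun k _ => Finset.sum_congr rfl fun l _ =>
      Finset.sum_congr rfl fun p _ => Finset.sum_congr rfl fun q _ => ?_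
    rw [hφ k l, star_neg, mul_neg, Complex.neg_re, mul_neg]
  have hexp : reForm (fun p q => sharpTerm R p.1 p.2 q.1 q.2) φ φ
      = 2 * (∑ i, ∑ j, ∑ k, ∑ l, ∑ p, ∑ q,
          comp R i p k q * comp R j p l q * (φ (i, j) * star (φ (k, l))).re)
        - 2 * (∑ i, ∑ j, ∑ k, ∑ l, ∑ p, ∑ q,
          comp R i p l q * comp R j p k q * (φ (i, j) * star (φ (k, l))).re) := by
    simp only [reForm, Fintype.sum_prod_type, sharpTerm, Finset.mul_sum, Finset.sum_mul,
      ← Finset.sum_sub_distrib]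
    refine Finset.sum_congr rfl fun i _ => Finset.sum_congr rfl fun j _ =>
      Finset.sum_congr rfl fun k _ => Finset.sum_congr rfl fun l _ =>
      Finset.sum_congr rfl fun p _ => Finset.sum_congr rfl fun q _ => ?_
    ring
  rw [hexp, hsw]
  ring

/-- R² is a Gram form: its value at φ is the squared norm of the image of φ under R. -/
theorem reForm_sqTerm_nonneg (R : AlgCurv ι) (φ : ι × ι → ℂ) :
    0 ≤ reForm (fun p q => sqTerm R p.1 p.2 q.1 q.2) φ φ := by
  have h : reForm (fun p q => sqTerm R p.1 p.2 q.1 q.2) φ φ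
      = ∑ p, ∑ q, Complex.normSq (∑ a : ι × ι, comp R a.1 a.2 p q * φ a) := by
    have e : ∀ p q, Complex.normSq (∑ a : ι × ι, comp R a.1 a.2 p q * φ a)
        = ∑ a : ι × ι, ∑ b : ι × ι, comp R a.1 a.2 p q * comp R b.1 b.2 p q
          * (φ a * star (φ b)).re := fun p q => by
      rw [← Complex.ofReal_re (Complex.normSq _), ← Complex.mul_conj, map_sum,
        Finset.sum_mul_sum, Complex.re_sum]
      refine Finset.sum_congr rfl fun a _ => ?_
      rw [Complex.re_sum]
      refine Finset.sum_congr rfl fun b _ => ?_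
      simp
      ring
    simp only [e, reForm, sqTerm, Finset.sum_mul]
    exact sum_sum_comm _
  rw [h]
  exact Finset.sum_nonneg fun p _ => Finset.sum_nonneg fun q _ => Complex.normSq_nonneg _

theorem curvMatrix_Q (R : AlgCurv ι) :
    curvMatrix (Q R) = Matrix.of (fun p q => sqTerm R p.1 p.2 q.1 q.2)
      + Matrix.of fun p q => sharpTerm R p.1 p.2 q.1 q.2 := rfl

end AlgCurv

/-! ### Complex orthogonal one-parameter groups -/

theorem hasDerivAt_biv {ι : Type*} [Fintype ι] {z w : ℝ → ι → ℂ} {z' w' : ι → ℂ} {s : ℝ}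
    (hz : HasDerivAt z z' s) (hw : HasDerivAt w w' s) :
    HasDerivAt (fun s => biv (z s) (w s)) (biv z' (w s) + biv (z s) w') s := by
  rw [hasDerivAt_pi] at hz hw ⊢
  intro p
  have h := ((hz p.1).mul (hw p.2)).sub ((hz p.2).mul (hw p.1))
  refine h.congr_deriv ?_
  simp only [Pi.add_apply, biv]
  ring

theorem gramDet_mulVec {ι : Type*} [Fintype ι] [DecidableEq ι] {g : Matrix ι ι ℂ}
    (hg : gᵀ * g = 1) (z w : ι → ℂ) : gramDet (g *ᵥ z) (g *ᵥ w) = gramDet z w := by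
  have h : ∀ u v : ι → ℂ, (g *ᵥ u) ⬝ᵥ (g *ᵥ v) = u ⬝ᵥ v := fun u v => by
    rw [Matrix.dotProduct_mulVec, ← Matrix.vecMul_transpose, Matrix.vecMul_vecMul, hg,
      Matrix.vecMul_one]
  simp only [gramDet, h]

section

attribute [local instance] Matrix.linftyOpNormedRing Matrix.linftyOpNormedAlgebra
  Matrix.linftyOpNormedAddCommGroup

/-- The orbit of a vector under the one-parameter group generated by `Y`. -/
noncomputable def expOrbit {ι : Type*} [Fintype ι] [DecidableEq ι] (Y : Matrix ι ι ℂ) (z : ι → ℂ)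
    (s : ℝ) : ι → ℂ :=
  NormedSpace.exp (s • Y) *ᵥ z

theorem expOrbit_zero {ι : Type*} [Fintype ι] [DecidableEq ι] (Y : Matrix ι ι ℂ) (z : ι → ℂ) :
    expOrbit Y z 0 = z := by
  simp [expOrbit, NormedSpace.exp_zero]

theorem hasDerivAt_expOrbit {ι : Type*} [Fintype ι] [DecidableEq ι] (Y : Matrix ι ι ℂ)
    (z : ι → ℂ) (s : ℝ) : HasDerivAt (expOrbit Y z) (Y *ᵥ expOrbit Y z s) s := by
  have h := hasDerivAt_exp_smul_const' (𝕂 := ℝ) Y s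
  let L : Matrix ι ι ℂ →ₗ[ℝ] (ι → ℂ) :=
    { toFun := fun A => A *ᵥ z
      map_add' := fun A B => Matrix.add_mulVec A B z
      map_smul' := fun c A => Matrix.smul_mulVec c A z }
  have h2 := (LinearMap.toContinuousLinearMap L).hasFDerivAt.comp_hasDerivAt s h
  refine h2.congr_deriv ?_
  exact (Matrix.mulVec_mulVec z Y _).symm

theorem transpose_exp_mul_exp {ι : Type*} [Fintype ι] [DecidableEq ι] {Y : Matrix ι ι ℂ}
    (hY : Yᵀ = -Y) (s : ℝ) :
    (NormedSpace.exp (s • Y))ᵀ * NormedSpace.exp (s • Y) = 1 := by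
  rw [← Matrix.exp_transpose, Matrix.transpose_smul, hY, smul_neg, ← Matrix.exp_add_of_commute]
  · simp [NormedSpace.exp_zero]
  · exact (Commute.refl _).neg_left

end

/-- For antisymmetric Y the matrix exp(sY) is complex orthogonal, so it preserves the bilinear dot
product. -/
theorem gramDet_expOrbit {ι : Type*} [Fintype ι] [DecidableEq ι] {Y : Matrix ι ι ℂ}
    (hY : Yᵀ = -Y) (z w : ι → ℂ) (s : ℝ) :
    gramDet (expOrbit Y z s) (expOrbit Y w s) = gramDet z w :=
  gramDet_mulVec (transpose_exp_mul_exp hY s) z w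

/-! ### Second variation at a zero, and the sign of Q there -/

namespace AlgCurv

variable {ι : Type*} [Fintype ι]

/-- Four times `R(z, w, z̄, w̄) + |(z·z)(w·w) - (z·w)²|`. -/
noncomputable def isoForm (R : AlgCurv ι) (z w : ι → ℂ) : ℝ :=
  reForm (curvMatrix R) (biv z w) (biv z w) + 4 * ‖gramDet z w‖

/-- The Gram term is constant along the orbit of exp(sY), so the curvature term alone is minimal at
s = 0. -/
theorem second_variation [DecidableEq ι] {R : AlgCurv ι} (hR : ∀ z w, 0 ≤ isoForm R z w)
    {z w : ι → ℂ} (h0 : isoForm R z w = 0) {Y : Matrix ι ι ℂ} (hY : Yᵀ = -Y) :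
    0 ≤ reForm (curvMatrix R) (biv (Y *ᵥ z) w + biv z (Y *ᵥ w))
      (biv (Y *ᵥ z) w + biv z (Y *ᵥ w)) := by
  set C := curvMatrix R with hC
  have key : ∀ Y : Matrix ι ι ℂ, Yᵀ = -Y →
      0 ≤ 2 * reForm C (biv (Y *ᵥ z) w + biv z (Y *ᵥ w)) (biv (Y *ᵥ z) w + biv z (Y *ᵥ w))
        + 2 * reForm C (biv (Y *ᵥ (Y *ᵥ z)) w + biv (Y *ᵥ z) (Y *ᵥ w)
          + (biv (Y *ᵥ z) (Y *ᵥ w) + biv z (Y *ᵥ (Y *ᵥ w)))) (biv z w) := by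
    intro Y hY
    have hz := hasDerivAt_expOrbit Y z
    have hw := hasDerivAt_expOrbit Y w
    have hYd : ∀ {u : ℝ → ι → ℂ} {u' : ι → ℂ} {s : ℝ}, HasDerivAt u u' s →
        HasDerivAt (fun s => Y *ᵥ u s) (Y *ᵥ u') s := fun {u u' s} hu =>
      (LinearMap.toContinuousLinearMap
        (Y.mulVecLin.restrictScalars ℝ)).hasFDerivAt.comp_hasDerivAt s hu
    have d1 := fun s => hasDerivAt_biv (hz s) (hw s)
    have d2 := fun s => (hasDerivAt_biv (hYd (hz s)) (hw s)).add
      (hasDerivAt_biv (hz s) (hYd (hw s)))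
    have e1 := fun s => hasDerivAt_reForm C (d1 s) (d1 s)
    have e2 := ((hasDerivAt_reForm C (d2 0) (d1 0)).add (hasDerivAt_reForm C (d1 0) (d2 0)))
    have := second_deriv_nonneg_of_min e1 e2 fun s => by
      have h1 := hR (expOrbit Y z s) (expOrbit Y w s)
      rw [isoForm, gramDet_expOrbit hY] at h1
      rw [isoForm] at h0
      simp only [expOrbit_zero]
      linarith
    simp only [expOrbit_zero, Pi.add_apply] at this
    rw [reForm_symm C (curvMatrix_symm R) (biv z w)] at this
    linarith
  have k1 := key Y hY
  -- Replacing Y by iY multiplies the velocity by i, leaving its sesquilinear square unchanged, and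
  -- reverses the acceleration. The sum of the two inequalities is free of the acceleration.
  have k2 := key (Complex.I • Y) (by rw [Matrix.transpose_smul, hY, smul_neg])
  simp only [Matrix.smul_mulVec, Matrix.mulVec_smul, biv_smul_left, biv_smul_right, ← smul_add,
    reForm_smul_smul, smul_smul, Complex.I_mul_I, neg_smul, one_smul,
    Complex.normSq_I, biv_neg_left, biv_neg_right] at k2
  simp only [← neg_add, reForm_neg_left] at k2
  linarith

theorem reForm_Q_nonneg [DecidableEq ι] {R : AlgCurv ι} (hR : ∀ z w, 0 ≤ isoForm R z w)
    {z w : ι → ℂ} (h0 : isoForm R z w = 0) :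
    0 ≤ reForm (curvMatrix (Q R)) (biv z w) (biv z w) := by
  have h₁ : ∀ x, 0 ≤ reForm (curvMatrix R) (adMatrix (biv z w) *ᵥ x)
      (adMatrix (biv z w) *ᵥ x) := fun x => by
    have h := second_variation hR h0 (Y := Matrix.of fun a b => x (b, a) - x (a, b)) (by
      ext i j; simp)
    rw [← four_mul_reForm_self R _ _ (adMatrix_biv_mulVec z w x)] at h
    linarith
  have h₂ : ∀ x, 0 ≤ reForm (curvMatrix R) ((adMatrix (biv z w))ᴴ *ᵥ x)
      ((adMatrix (biv z w))ᴴ *ᵥ x) := fun x => by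
    rw [adMatrix_conjTranspose_mulVec _ (biv_swap z w), reForm_neg_left, reForm_neg_right, neg_neg,
      reForm_star]
    exact h₁ _
  have h := re_trace_mul_mul_conjTranspose_mul_nonneg _ (curvMatrix_symm R) _ h₁ h₂
  rw [trace_adMatrix R _ (biv_swap z w)] at h
  rw [curvMatrix_Q, reForm_add_matrix]
  exact add_nonneg (reForm_sqTerm_nonneg R _) h

end AlgCurv

/-! ### Complex vectors and orthonormal four-frames -/

/-- The complex vector `a + i b`. -/
def complexVec {ι : Type*} (a b : EuclideanSpace ℝ ι) : ι → ℂ := fun i => ⟨a i, b i⟩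

theorem complexVec_dotProduct {ι : Type*} [Fintype ι] (a b c d : EuclideanSpace ℝ ι) :
    complexVec a b ⬝ᵥ complexVec c d
      = ⟨inner ℝ a c - inner ℝ b d, inner ℝ a d + inner ℝ b c⟩ := by
  apply Complex.ext <;>
    simp [complexVec, dotProduct, PiLp.inner_apply, Finset.sum_add_distrib, mul_comm]

theorem star_complexVec_dotProduct {ι : Type*} [Fintype ι] (a b c d : EuclideanSpace ℝ ι) :
    star (complexVec a b) ⬝ᵥ complexVec c d
      = ⟨inner ℝ a c + inner ℝ b d, inner ℝ a d - inner ℝ b c⟩ := by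
  apply Complex.ext
  · simp [complexVec, dotProduct, PiLp.inner_apply, Finset.sum_add_distrib, mul_comm]
  · simp [complexVec, dotProduct, PiLp.inner_apply, Finset.sum_add_distrib, mul_comm]
    ring

theorem biv_self {ι : Type*} (z : ι → ℂ) : biv z z = 0 := by
  ext p; simp [biv, mul_comm]

theorem biv_complexVec {ι : Type*} (a b c d : EuclideanSpace ℝ ι) :
    biv (complexVec a b) (complexVec c d)
      = (biv (complexVec a 0) (complexVec c 0) + -biv (complexVec b 0) (complexVec d 0))
        + Complex.I • (biv (complexVec a 0) (complexVec d 0)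
          + biv (complexVec b 0) (complexVec c 0)) := by
  ext p
  apply Complex.ext <;> simp [biv, complexVec] <;> ring

theorem reForm_add_I_smul {κ : Type*} [Fintype κ] (T : Matrix κ κ ℝ) {x y : κ → ℂ}
    (hx : ∀ p, (x p).im = 0) (hy : ∀ p, (y p).im = 0) :
    reForm T (x + Complex.I • y) (x + Complex.I • y) = reForm T x x + reForm T y y := by
  simp only [reForm, ← Finset.sum_add_distrib]
  refine Finset.sum_congr rfl fun p _ => Finset.sum_congr rfl fun q _ => ?_
  simp [hx, hy]
  ring

/-- Two orthogonal complex vectors of squared norm `2`. -/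
def IsUnitaryPair {ι : Type*} [Fintype ι] (z w : ι → ℂ) : Prop :=
  star z ⬝ᵥ z = 2 ∧ star w ⬝ᵥ w = 2 ∧ star z ⬝ᵥ w = 0

theorem star_smul_dotProduct_smul {ι : Type*} [Fintype ι] (a b : ℂ) (z w : ι → ℂ) :
    star (a • z) ⬝ᵥ (b • w) = star a * b * (star z ⬝ᵥ w) := by
  rw [star_smul, smul_dotProduct, dotProduct_smul, smul_eq_mul, smul_eq_mul, mul_assoc]

theorem exists_smul_normSq_eq_two {ι : Type*} [Fintype ι] {v : ι → ℂ} (hv : v ≠ 0) :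
    ∃ c : ℂ, c ≠ 0 ∧ star (c • v) ⬝ᵥ (c • v) = 2 := by
  have h1 : star v ⬝ᵥ v = ((∑ i, Complex.normSq (v i) : ℝ) : ℂ) := by
    simp only [dotProduct, Complex.ofReal_sum, Complex.normSq_eq_conj_mul_self]
    rfl
  have h2 : (0 : ℝ) < ∑ i, Complex.normSq (v i) := by
    obtain ⟨i, hi⟩ := Function.ne_iff.1 hv
    exact Finset.sum_pos' (fun _ _ => Complex.normSq_nonneg _)
      ⟨i, Finset.mem_univ i, Complex.normSq_pos.2 hi⟩
  set r := ∑ i, Complex.normSq (v i)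
  have h3 : 0 < Real.sqrt (2 / r) := Real.sqrt_pos.2 (by positivity)
  refine ⟨(Real.sqrt (2 / r) : ℝ), by exact_mod_cast h3.ne', ?_⟩
  rw [star_smul_dotProduct_smul, h1, Complex.star_def, Complex.conj_ofReal, ← Complex.ofReal_mul,
    ← Complex.ofReal_mul, Real.mul_self_sqrt (by positivity), div_mul_cancel₀ _ h2.ne']
  norm_num

/-- Hermitian Gram–Schmidt: z ∧ w ≠ 0 means linear independence. The triangular form of the change
of basis keeps z ∧ w up to the scalar ad. -/
theorem exists_isUnitaryPair {ι : Type*} [Fintype ι] {z w : ι → ℂ} (h : biv z w ≠ 0) :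
    ∃ a b d : ℂ, a ≠ 0 ∧ d ≠ 0 ∧ IsUnitaryPair (a • z) (b • z + d • w) := by
  have hz : z ≠ 0 := by
    rintro rfl
    apply h
    ext p; simp [biv]
  obtain ⟨a, ha, haz⟩ := exists_smul_normSq_eq_two hz
  set t := star (a • z) ⬝ᵥ w
  have hw : w + (-(t / 2) * a) • z ≠ 0 := by
    intro h0
    apply h
    have : biv z (w + (-(t / 2) * a) • z) = biv z w := by
      rw [biv_add_right, biv_smul_right, biv_self, smul_zero, add_zero]
    rw [← this, h0]
    ext p; simp [biv]
  obtain ⟨d, hd, hdw⟩ := exists_smul_normSq_eq_two hw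
  have he : (d * (-(t / 2) * a)) • z + d • w = d • (w + (-(t / 2) * a) • z) := by
    rw [smul_add, smul_smul, add_comm]
  refine ⟨a, d * (-(t / 2) * a), d, ha, hd, haz, ?_, ?_⟩
  · rw [he, hdw]
  · rw [he, dotProduct_smul, dotProduct_add, mul_smul, dotProduct_smul, haz]
    simp [t]

theorem gramDet_smul_add {ι : Type*} [Fintype ι] (a b d : ℂ) (z w : ι → ℂ) :
    gramDet (a • z) (b • z + d • w) = (a * d) ^ 2 * gramDet z w := by
  simp only [gramDet, dotProduct_add, add_dotProduct, dotProduct_smul, smul_dotProduct,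
    smul_eq_mul, dotProduct_comm w z]
  ring

/-- Isotropy makes the real and imaginary parts of each vector orthogonal and of equal length, and
the squared norm 2 makes that length 1. The Hermitian and bilinear products of z and w together kill
the four mixed inner products. -/
theorem exists_orthonormal_of_isUnitaryPair {ι : Type*} [Fintype ι] {z w : ι → ℂ}
    (h : IsUnitaryPair z w) (hzz : z ⬝ᵥ z = 0) (hww : w ⬝ᵥ w = 0) (hzw : z ⬝ᵥ w = 0) :
    ∃ e : Fin 4 → EuclideanSpace ℝ ι, Orthonormal ℝ e ∧ complexVec (e 0) (e 1) = z ∧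
      complexVec (e 2) (e 3) = w := by
  let a : EuclideanSpace ℝ ι := WithLp.toLp 2 fun i => (z i).re
  let b : EuclideanSpace ℝ ι := WithLp.toLp 2 fun i => (z i).im
  let c : EuclideanSpace ℝ ι := WithLp.toLp 2 fun i => (w i).re
  let d : EuclideanSpace ℝ ι := WithLp.toLp 2 fun i => (w i).im
  have hz : complexVec a b = z := rfl
  have hw : complexVec c d = w := rfl
  obtain ⟨h1, h2, h3⟩ := h
  rw [← hz] at h1 h3 hzz hzw ⊢
  rw [← hw] at h2 h3 hww hzw ⊢
  rw [star_complexVec_dotProduct, Complex.ext_iff] at h1 h2 h3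
  rw [complexVec_dotProduct, Complex.ext_iff] at hzz hww hzw
  simp only [Complex.re_ofNat, Complex.im_ofNat, Complex.zero_re, Complex.zero_im]
    at h1 h2 h3 hzz hww hzw
  refine ⟨![a, b, c, d], ?_, rfl, rfl⟩
  rw [orthonormal_iff_ite]
  intro i j
  have s1 := real_inner_comm a b
  have s2 := real_inner_comm a c
  have s3 := real_inner_comm a d
  have s4 := real_inner_comm b c
  have s5 := real_inner_comm b d
  have s6 := real_inner_comm c d
  fin_cases i <;> fin_cases j <;>
    simp [-inner_self_eq_norm_sq_to_K] <;> linarith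

/-- Every complex symmetric `2 × 2` matrix is the bilinear Gram matrix of two vectors. -/
theorem exists_gram_eq (p q r : ℂ) :
    ∃ ζ ω : Fin 2 → ℂ, ζ ⬝ᵥ ζ = p ∧ ω ⬝ᵥ ω = q ∧ ζ ⬝ᵥ ω = r := by
  simp only [dotProduct, Fin.sum_univ_two]
  by_cases hp : p = 0
  -- Here ζ = r(1, i) is isotropic, and ω solves ω₀ + iω₁ = 1, ω₀ - iω₁ = q.
  · refine ⟨![r, r * Complex.I], ![(1 + q) / 2, -Complex.I * (1 - q) / 2], ?_, ?_, ?_⟩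
    · simp [hp]; linear_combination r ^ 2 * Complex.I_mul_I
    · simp; linear_combination (1 - q) ^ 2 / 4 * Complex.I_mul_I
    · simp; linear_combination -r * (1 - q) / 2 * Complex.I_mul_I
  · obtain ⟨s, hs⟩ := IsAlgClosed.exists_eq_mul_self p
    obtain ⟨u, hu⟩ := IsAlgClosed.exists_eq_mul_self (q - r ^ 2 / p)
    have hs0 : s ≠ 0 := by
      rintro rfl
      simp [hs] at hp
    refine ⟨![s, 0], ![r / s, u], ?_, ?_, ?_⟩
    · simp [hs]
    · simp [← hu, hs]; field_simp; ring
    · simp; field_simp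

/-! ### Complex characterisation of `E` -/

namespace AlgCurv

theorem reForm_biv_real {ι : Type*} [Fintype ι] (R : AlgCurv ι) (a b c d : EuclideanSpace ℝ ι) :
    reForm (curvMatrix R) (biv (complexVec a 0) (complexVec b 0))
      (biv (complexVec c 0) (complexVec d 0)) = 4 * eval R a b c d := by
  have h : reForm (curvMatrix R) (biv (complexVec a 0) (complexVec b 0))
      (biv (complexVec c 0) (complexVec d 0))
      = eval R a b c d - eval R b a c d - (eval R a b d c - eval R b a d c) := by
    simp only [reForm, Fintype.sum_prod_type, eval, ← Finset.sum_sub_distrib]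
    refine Finset.sum_congr rfl fun i _ => Finset.sum_congr rfl fun j _ =>
      Finset.sum_congr rfl fun k _ => Finset.sum_congr rfl fun l _ => ?_
    simp [biv, complexVec, curvMatrix]
    ring
  rw [h, eval_swap R a b, eval_swap R a b, ← eval_pair R a b d c, eval_swap R c d, eval_pair]
  ring

theorem reForm_biv_complexVec {ι : Type*} [Fintype ι] (R : AlgCurv ι)
    (a b c d : EuclideanSpace ℝ ι) :
    reForm (curvMatrix R) (biv (complexVec a b) (complexVec c d))
      (biv (complexVec a b) (complexVec c d))
      = 4 * (eval R a c a c + eval R a d a d + eval R b c b c + eval R b d b d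
        - 2 * eval R a b c d) := by
  rw [biv_complexVec, reForm_add_I_smul _ (by simp [biv, complexVec]) (by simp [biv, complexVec])]
  simp only [reForm_add_left, reForm_add_right, reForm_neg_left, reForm_neg_right,
    reForm_biv_real]
  -- The cross terms are -2R(a,c,b,d) + 2R(a,d,b,c), which the Bianchi identity turns into
  -- -2R(a,b,c,d).
  have h1 := eval_bianchi R a b c d
  have h2 : eval R a c d b = -eval R a c b d := by
    rw [← eval_pair R a c d b, eval_swap R b d, eval_pair]
  rw [eval_pair R a c b d, eval_pair R a d b c]
  linarith

/-- Isotropy makes the two Gram matrices opposite, a 2 × 2 determinant ignores the sign, and in ℂ²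
the Gram determinant is the square of the determinant. -/
theorem gramDet_inl_eq {n : ℕ} {z w : Fin n ⊕ Fin 2 → ℂ} (hzz : z ⬝ᵥ z = 0) (hww : w ⬝ᵥ w = 0)
    (hzw : z ⬝ᵥ w = 0) :
    gramDet (fun i => z (Sum.inl i)) (fun i => w (Sum.inl i))
      = (z (Sum.inr 0) * w (Sum.inr 1) - z (Sum.inr 1) * w (Sum.inr 0)) ^ 2 := by
  simp only [dotProduct, Fintype.sum_sum_type, Fin.sum_univ_two] at hzz hww hzw
  simp only [gramDet, dotProduct]
  rw [eq_neg_of_add_eq_zero_left hzz, eq_neg_of_add_eq_zero_left hww,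
    eq_neg_of_add_eq_zero_left hzw]
  ring

theorem isoForm_eq_of_orthonormal {n : ℕ} (R : AlgCurv (Fin n))
    {e : Fin 4 → EuclideanSpace ℝ (Fin n ⊕ Fin 2)} (he : Orthonormal ℝ e) :
    isoForm R (complexVec (fstPart (e 0)) (fstPart (e 1)))
        (complexVec (fstPart (e 2)) (fstPart (e 3)))
      = 4 * (eval (induced R) (e 0) (e 2) (e 0) (e 2) + eval (induced R) (e 0) (e 3) (e 0) (e 3)
        + eval (induced R) (e 1) (e 2) (e 1) (e 2) + eval (induced R) (e 1) (e 3) (e 1) (e 3)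
        - 2 * eval (induced R) (e 0) (e 1) (e 2) (e 3)) := by
  rw [orthonormal_iff_ite] at he
  have hg := gramDet_inl_eq (z := complexVec (e 0) (e 1)) (w := complexVec (e 2) (e 3))
    (by rw [complexVec_dotProduct]; simp only [he]; simp; rfl)
    (by rw [complexVec_dotProduct]; simp only [he]; simp; rfl)
    (by rw [complexVec_dotProduct]; simp only [he]; simp; rfl)
  have hg' : ‖gramDet (complexVec (fstPart (e 0)) (fstPart (e 1)))
      (complexVec (fstPart (e 2)) (fstPart (e 3)))‖ = Complex.normSq
      (complexVec (e 0) (e 1) (Sum.inr 0) * complexVec (e 2) (e 3) (Sum.inr 1)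
        - complexVec (e 0) (e 1) (Sum.inr 1) * complexVec (e 2) (e 3) (Sum.inr 0)) := by
    rw [Complex.normSq_eq_norm_sq, ← norm_pow, ← hg]
    rfl
  rw [isoForm, hg', reForm_biv_complexVec]
  simp only [eval_induced, productForm, PiLp.inner_apply, Fin.sum_univ_two, sndPart, complexVec,
    Complex.normSq_apply]
  simp
  ring

/-- The bivector scales by ad and the Gram determinant by (ad)², so both terms scale by |ad|²; this
permits testing on unitary pairs only. -/
theorem isoForm_smul_add {ι : Type*} [Fintype ι] (R : AlgCurv ι) (a b d : ℂ) (z w : ι → ℂ) :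
    isoForm R (a • z) (b • z + d • w) = Complex.normSq (a * d) * isoForm R z w := by
  rw [isoForm, gramDet_smul_add, biv_add_right, biv_smul_left, biv_smul_right, biv_self,
    smul_zero, smul_zero, zero_add, biv_smul_left, biv_smul_right, smul_smul, reForm_smul_smul,
    norm_mul, norm_pow, ← Complex.normSq_eq_norm_sq, isoForm]
  ring

theorem isoForm_nonneg_of_biv_eq_zero {ι : Type*} [Fintype ι] (R : AlgCurv ι) {z w : ι → ℂ}
    (h : biv z w = 0) : 0 ≤ isoForm R z w := by
  rw [isoForm, h, reForm_zero_left, zero_add]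
  positivity

theorem mem_E_iff {n : ℕ} (R : AlgCurv (Fin n)) : R ∈ E n ↔ ∀ z w, 0 ≤ isoForm R z w := by
  constructor
  · intro h z w
    obtain ⟨ζ, ω, h1, h2, h3⟩ := exists_gram_eq (-(z ⬝ᵥ z)) (-(w ⬝ᵥ w)) (-(z ⬝ᵥ w))
    set zz : Fin n ⊕ Fin 2 → ℂ := Sum.elim z ζ with hzz
    set ww : Fin n ⊕ Fin 2 → ℂ := Sum.elim w ω with hww
    have i1 : zz ⬝ᵥ zz = 0 := by rw [hzz, sumElim_dotProduct_sumElim, h1, add_neg_cancel]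
    have i2 : ww ⬝ᵥ ww = 0 := by rw [hww, sumElim_dotProduct_sumElim, h2, add_neg_cancel]
    have i3 : zz ⬝ᵥ ww = 0 := by rw [hzz, hww, sumElim_dotProduct_sumElim, h3, add_neg_cancel]
    -- A dependent lift cannot be normalised, but then z ∧ w = 0 and only the Gram term remains.
    by_cases hb : biv zz ww = 0
    · refine isoForm_nonneg_of_biv_eq_zero R ?_
      ext ⟨i, j⟩
      exact congrFun hb (Sum.inl i, Sum.inl j)
    obtain ⟨a, b, d, ha, hd, hu⟩ := exists_isUnitaryPair hb
    obtain ⟨e, he, e1, e2⟩ := exists_orthonormal_of_isUnitaryPair hu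
      (by simp [i1]) (by simp [i1, i2, i3, dotProduct_comm ww zz]) (by simp [i1, i3])
    have h4 := isoForm_eq_of_orthonormal R he
    have e1' : complexVec (fstPart (e 0)) (fstPart (e 1)) = a • z := by
      ext i
      exact congrFun e1 (Sum.inl i)
    have e2' : complexVec (fstPart (e 2)) (fstPart (e 3)) = b • z + d • w := by
      ext i
      exact congrFun e2 (Sum.inl i)
    rw [e1', e2', isoForm_smul_add] at h4
    have h5 := h e he
    have h6 : 0 < Complex.normSq (a * d) := Complex.normSq_pos.2 (mul_ne_zero ha hd)
    exact nonneg_of_mul_nonneg_right (by rw [h4]; linarith) h6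
  · intro h e he
    have h1 := h (complexVec (fstPart (e 0)) (fstPart (e 1)))
      (complexVec (fstPart (e 2)) (fstPart (e 3)))
    rw [isoForm_eq_of_orthonormal R he] at h1
    linarith

end AlgCurv

/-! ### First touching time and compactness of unitary pairs -/

/-- A first-touching-time principle: a function which is positive at time `0` and has positive
time derivative whenever it first touches zero stays positive. -/
theorem pos_of_deriv_pos_of_first_zero {X : Type*} [TopologicalSpace X] {Ω : Set X}
    (hΩ : IsCompact Ω) {b : ℝ} {F : ℝ → X → ℝ}
    (hF : ContinuousOn (fun p : ℝ × X => F p.1 p.2) (Set.Icc 0 b ×ˢ Ω))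
    (h0 : ∀ x ∈ Ω, 0 < F 0 x)
    (hd : ∀ t ∈ Set.Icc 0 b, (∀ y ∈ Ω, 0 ≤ F t y) → ∀ x ∈ Ω, F t x = 0 →
      ∃ d, 0 < d ∧ HasDerivWithinAt (fun s => F s x) d (Set.Icc 0 b) t) :
    ∀ t ∈ Set.Icc 0 b, ∀ x ∈ Ω, 0 < F t x := by
  by_contra! hcon
  obtain ⟨t₁, ht₁, x₁, hx₁, hle₁⟩ := hcon
  set A : Set (ℝ × X) := {p ∈ Set.Icc 0 b ×ˢ Ω | F p.1 p.2 ≤ 0} with hA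
  have hAc : IsCompact A := by
    have hK : IsCompact (Set.Icc (0 : ℝ) b ×ˢ Ω) := isCompact_Icc.prod hΩ
    obtain ⟨u, hu, huA⟩ := continuousOn_iff_isClosed.1 hF _ (isClosed_Iic (a := 0))
    have : A = u ∩ Set.Icc (0 : ℝ) b ×ˢ Ω := by
      rw [← huA, Set.inter_comm]
      rfl
    rw [this]
    exact hK.inter_left hu
  -- A point of least time in the compact set where F ≤ 0.
  obtain ⟨⟨t₀, x₀⟩, ⟨⟨ht₀, hx₀⟩, hle₀⟩, hmin⟩ :=
    hAc.exists_isMinOn ⟨(t₁, x₁), ⟨ht₁, hx₁⟩, hle₁⟩ continuous_fst.continuousOn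
  simp only at ht₀ hx₀ hle₀
  have hpos : ∀ t ∈ Set.Ico 0 t₀, ∀ y ∈ Ω, 0 < F t y := by
    intro t ht y hy
    by_contra! hn
    have := hmin (show (t, y) ∈ A from ⟨⟨⟨ht.1, ht.2.le.trans ht₀.2⟩, hy⟩, hn⟩)
    exact absurd ht.2 (not_lt.2 this)
  have ht₀pos : 0 < t₀ := by
    rcases ht₀.1.eq_or_lt with h | h
    · rw [← h] at hle₀
      exact absurd (h0 x₀ hx₀) (not_lt.2 hle₀)
    · exact h
  have hsub : Set.Ico 0 t₀ ⊆ Set.Icc 0 b := fun s hs => ⟨hs.1, hs.2.le.trans ht₀.2⟩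
  have hne : (nhdsWithin t₀ (Set.Ico 0 t₀)).NeBot := by
    rw [← mem_closure_iff_nhdsWithin_neBot, closure_Ico ht₀pos.ne]
    exact ⟨ht₀pos.le, le_rfl⟩
  have hnn : ∀ y ∈ Ω, 0 ≤ F t₀ y := by
    intro y hy
    have hc : ContinuousOn (fun t => F t y) (Set.Icc 0 b) :=
      hF.comp (f := fun t => (t, y)) (by fun_prop) fun t ht => ⟨ht, hy⟩
    refine ge_of_tendsto ((hc t₀ ht₀).mono hsub) ?_
    filter_upwards [self_mem_nhdsWithin] with t ht using (hpos t ht y hy).le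
  have hz : F t₀ x₀ = 0 := le_antisymm hle₀ (hnn x₀ hx₀)
  obtain ⟨d, hdpos, hder⟩ := hd t₀ ht₀ hnn x₀ hx₀ hz
  -- Before t₀ the function is positive and at t₀ it is zero, so slopes from the left are
  -- nonpositive.
  have hs := (hasDerivWithinAt_iff_tendsto_slope' (by simp)).1 (hder.mono hsub)
  refine absurd (le_of_tendsto hs ?_) (not_le.2 hdpos)
  filter_upwards [self_mem_nhdsWithin] with t ht
  rw [slope_def_field, hz, sub_zero]
  exact div_nonpos_of_nonneg_of_nonpos (hpos t ht x₀ hx₀).le (sub_nonpos.2 ht.2.le)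

theorem isCompact_isUnitaryPair {ι : Type*} [Fintype ι] :
    IsCompact {p : (ι → ℂ) × (ι → ℂ) | IsUnitaryPair p.1 p.2} := by
  have hc : ∀ f g : (ι → ℂ) × (ι → ℂ) → ι → ℂ, Continuous f → Continuous g →
      Continuous fun p => star (f p) ⬝ᵥ g p := fun f g hf hg => by
    unfold dotProduct
    exact continuous_finsetSum _ fun i _ =>
      (((continuous_apply i).comp hf).star).mul ((continuous_apply i).comp hg)
  have hb : ∀ z : ι → ℂ, star z ⬝ᵥ z = 2 → ‖z‖ ≤ 2 := by
    intro z hz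
    refine (pi_norm_le_iff_of_nonneg zero_le_two).2 fun i => ?_
    have h1 : ∑ i, ‖z i‖ ^ 2 = 2 := by
      have := congrArg Complex.re hz
      simp only [dotProduct, Pi.star_apply, Complex.re_sum, Complex.re_ofNat] at this
      rw [← this]
      refine Finset.sum_congr rfl fun i _ => ?_
      rw [← Complex.normSq_eq_norm_sq, Complex.normSq_apply]
      simp
    have h2 : ‖z i‖ ^ 2 ≤ 2 := by
      rw [← h1]
      exact Finset.single_le_sum (f := fun i => ‖z i‖ ^ 2) (fun _ _ => by positivity)
        (Finset.mem_univ i)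
    nlinarith [norm_nonneg (z i)]
  refine Metric.isCompact_of_isClosed_isBounded ?_ ?_
  · exact ((isClosed_eq (hc _ _ continuous_fst continuous_fst) continuous_const)).inter
      ((isClosed_eq (hc _ _ continuous_snd continuous_snd) continuous_const).inter
        (isClosed_eq (hc _ _ continuous_fst continuous_snd) continuous_const))
  · refine (Metric.isBounded_closedBall (x := (0 : (ι → ℂ) × (ι → ℂ))) (r := 2)).subset ?_
    rintro ⟨z, w⟩ ⟨h1, h2, -⟩
    rw [mem_closedBall_zero_iff, Prod.norm_def]
    exact max_le (hb z h1) (hb w h2)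

theorem continuous_biv {ι : Type*} :
    Continuous fun p : (ι → ℂ) × (ι → ℂ) => biv p.1 p.2 := by
  unfold biv
  fun_prop

theorem continuous_gramDet {ι : Type*} [Fintype ι] :
    Continuous fun p : (ι → ℂ) × (ι → ℂ) => gramDet p.1 p.2 := by
  unfold gramDet dotProduct
  fun_prop

/-! ### Perturbation by constant curvature and the ODE -/

namespace AlgCurv

section

variable {ι : Type*}

/-- The curvature operator `δ_{ik} δ_{jl} - δ_{il} δ_{jk}` of constant curvature one. -/
def constCurv (ι : Type*) [DecidableEq ι] : AlgCurv ι :=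
  ⟨fun i j k l => (if i = k then 1 else 0) * (if j = l then 1 else 0)
    - (if i = l then 1 else 0) * (if j = k then 1 else 0), by
    refine ⟨fun i j k l => ?_, fun i j k l => ?_, fun i j k l => ?_⟩
    · ring
    · simp only [eq_comm (a := k) (b := i), eq_comm (a := k) (b := j), eq_comm (a := l) (b := i),
        eq_comm (a := l) (b := j)]
      ring
    · simp only [eq_comm (a := k) (b := j), eq_comm (a := l) (b := k), eq_comm (a := l) (b := j)]
      ring⟩

theorem comp_add_smul (R S : AlgCurv ι) (c : ℝ) (i j k l : ι) :
    comp (R + c • S) i j k l = comp R i j k l + c * comp S i j k l := rfl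

theorem continuous_comp (i j k l : ι) : Continuous fun R : AlgCurv ι => comp R i j k l :=
  (continuous_apply l).comp ((continuous_apply k).comp ((continuous_apply j).comp
    ((continuous_apply i).comp continuous_subtype_val)))

theorem continuous_curvMatrix : Continuous fun R : AlgCurv ι => curvMatrix R :=
  continuous_matrix fun p q => continuous_comp p.1 p.2 q.1 q.2

variable [Fintype ι]

theorem isoForm_add_smul (R S : AlgCurv ι) (c : ℝ) (z w : ι → ℂ) :
    isoForm (R + c • S) z w = isoForm R z w
      + c * reForm (curvMatrix S) (biv z w) (biv z w) := by
  have h : curvMatrix (R + c • S) = curvMatrix R + c • curvMatrix S := rfl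
  rw [isoForm, h, reForm_add_matrix, reForm_smul_matrix, isoForm]
  ring

/-- The value is 4(|z|²|w|² - |⟨z, w⟩|²) with |z|² = |w|² = 2. Its being a positive constant is what
makes this operator a useful perturbation. -/
theorem reForm_constCurv [DecidableEq ι] {z w : ι → ℂ} (h : IsUnitaryPair z w) :
    reForm (curvMatrix (constCurv ι)) (biv z w) (biv z w) = 16 := by
  have e1 : reForm (curvMatrix (constCurv ι)) (biv z w) (biv z w)
      = ∑ i, ∑ j, 2 * (biv z w (i, j) * star (biv z w (i, j))).re := by
    simp only [reForm, Fintype.sum_prod_type, curvMatrix, comp, constCurv]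
    refine Finset.sum_congr rfl fun i _ => Finset.sum_congr rfl fun j _ => ?_
    simp [sub_mul, Finset.sum_sub_distrib, biv_swap z w i j]
    ring
  have e2 : ∑ i, ∑ j, biv z w (i, j) * star (biv z w (i, j))
      = 2 * (star z ⬝ᵥ z) * (star w ⬝ᵥ w)
        - 2 * (star z ⬝ᵥ w) * (star w ⬝ᵥ z) := by
    have f1 : ∀ a b c d : ι → ℂ, (a ⬝ᵥ b) * (c ⬝ᵥ d) = ∑ i, ∑ j, a i * b i * (c j * d j) :=
      fun a b c d => by simp only [dotProduct, Finset.sum_mul_sum]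
    have f2 : 2 * (star z ⬝ᵥ z) * (star w ⬝ᵥ w) - 2 * (star z ⬝ᵥ w) * (star w ⬝ᵥ z)
        = (star z ⬝ᵥ z) * (star w ⬝ᵥ w) + (star w ⬝ᵥ w) * (star z ⬝ᵥ z)
          - (star z ⬝ᵥ w) * (star w ⬝ᵥ z) - (star w ⬝ᵥ z) * (star z ⬝ᵥ w) := by ring
    rw [f2]
    simp only [f1, ← Finset.sum_add_distrib, ← Finset.sum_sub_distrib]
    refine Finset.sum_congr rfl fun i _ => Finset.sum_congr rfl fun j _ => ?_
    simp [biv]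
    ring
  rw [e1]
  simp only [← Finset.mul_sum, ← Complex.re_sum]
  rw [e2, h.1, h.2.1, h.2.2]
  norm_num

/-- Taylor expansion of a quadratic map, with the mixed term written as Q(R + S) - Q(R) - Q(S). -/
theorem curvMatrix_Q_add_smul (R S : AlgCurv ι) (c : ℝ) :
    curvMatrix (Q (R + c • S)) = curvMatrix (Q R) + c • (curvMatrix (Q (R + S))
      + (-1 : ℝ) • curvMatrix (Q R) + (c - 1) • curvMatrix (Q S)) := by
  have h1 : ∀ i j k l, comp (R + S) i j k l = comp R i j k l + comp S i j k l :=
    fun _ _ _ _ => rfl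
  ext ⟨i, j⟩ ⟨k, l⟩
  simp only [curvMatrix_Q, Matrix.add_apply, Matrix.smul_apply, Matrix.of_apply, smul_eq_mul,
    sqTerm, sharpTerm, ← Finset.sum_add_distrib, Finset.mul_sum, comp_add_smul, h1]
  refine Finset.sum_congr rfl fun p _ => Finset.sum_congr rfl fun q _ => ?_
  ring

theorem continuous_curvMatrix_Q : Continuous fun R : AlgCurv ι => curvMatrix (Q R) := by
  refine continuous_matrix fun p q => ?_
  have := fun i j k l => continuous_comp (ι := ι) i j k l
  simp only [curvMatrix_Q, Matrix.add_apply, Matrix.of_apply, sqTerm, sharpTerm]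
  fun_prop

theorem isoForm_nonneg_of_isUnitaryPair {R : AlgCurv ι}
    (h : ∀ z w, IsUnitaryPair z w → 0 ≤ isoForm R z w) (z w : ι → ℂ) : 0 ≤ isoForm R z w := by
  by_cases hb : biv z w = 0
  · exact isoForm_nonneg_of_biv_eq_zero R hb
  obtain ⟨a, b, d, ha, hd, hu⟩ := exists_isUnitaryPair hb
  have h1 := h _ _ hu
  rw [isoForm_smul_add] at h1
  exact nonneg_of_mul_nonneg_right h1 (Complex.normSq_pos.2 (mul_ne_zero ha hd))

theorem hasDerivWithinAt_isoForm {R : ℝ → AlgCurv ι} {R' : AlgCurv ι} {s : Set ℝ} {t : ℝ}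
    (hR : HasDerivWithinAt R R' s t) (z w : ι → ℂ) :
    HasDerivWithinAt (fun t => isoForm (R t) z w)
      (reForm (curvMatrix R') (biv z w) (biv z w)) s t := by
  let L : AlgCurv ι →ₗ[ℝ] ℝ :=
    { toFun := fun R => reForm (curvMatrix R) (biv z w) (biv z w)
      map_add' := fun A B => reForm_add_matrix (curvMatrix A) (curvMatrix B) _ _
      map_smul' := fun c A => reForm_smul_matrix (curvMatrix A) c _ _ }
  exact ((LinearMap.toContinuousLinearMap L).hasFDerivAt.comp_hasDerivWithinAt t hR).add_const _

theorem continuousOn_reForm_biv {X : Type*} [TopologicalSpace X] {s : Set X}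
    {A : X → Matrix (ι × ι) (ι × ι) ℝ} {p : X → (ι → ℂ) × (ι → ℂ)} (hA : ContinuousOn A s)
    (hp : ContinuousOn p s) :
    ContinuousOn (fun x => reForm (A x) (biv (p x).1 (p x).2) (biv (p x).1 (p x).2)) s := by
  have hb : ContinuousOn (fun x => biv (p x).1 (p x).2) s := continuous_biv.comp_continuousOn hp
  exact continuousOn_reForm hA hb hb

theorem continuousOn_isoForm {X : Type*} [TopologicalSpace X] {s : Set X}
    {R : X → AlgCurv ι} {p : X → (ι → ℂ) × (ι → ℂ)} (hR : ContinuousOn R s)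
    (hp : ContinuousOn p s) : ContinuousOn (fun x => isoForm (R x) (p x).1 (p x).2) s :=
  (continuousOn_reForm_biv (continuous_curvMatrix.comp_continuousOn hR) hp).add
    (continuousOn_const.mul (continuous_gramDet.comp_continuousOn hp).norm)

/-- A Lipschitz bound for the values of `Q` in the direction of a fixed operator `J`, along a
compact curve of curvature operators and on unitary pairs. -/
theorem exists_Q_add_smul_le {R : ℝ → AlgCurv ι} {b : ℝ} (hR : ContinuousOn R (Set.Icc 0 b))
    (J : AlgCurv ι) :
    ∃ L : ℝ, 0 ≤ L ∧ ∀ t ∈ Set.Icc 0 b, ∀ z w, IsUnitaryPair z w → ∀ δ : ℝ, 0 ≤ δ → δ ≤ 1 →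
      reForm (curvMatrix (Q (R t + δ • J))) (biv z w) (biv z w)
        ≤ reForm (curvMatrix (Q (R t))) (biv z w) (biv z w) + δ * L := by
  set K := Set.Icc 0 b ×ˢ {p : (ι → ℂ) × (ι → ℂ) | IsUnitaryPair p.1 p.2} with hK
  have hKc : IsCompact K := isCompact_Icc.prod isCompact_isUnitaryPair
  have hcR : ContinuousOn (fun p : ℝ × (ι → ℂ) × (ι → ℂ) => R p.1) K :=
    hR.comp continuous_fst.continuousOn fun p hp => hp.1
  have hbd : ∀ S : ℝ × (ι → ℂ) × (ι → ℂ) → AlgCurv ι, ContinuousOn S K → ∃ M, ∀ p ∈ K,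
      ‖reForm (curvMatrix (Q (S p))) (biv p.2.1 p.2.2) (biv p.2.1 p.2.2)‖ ≤ M := fun S hS =>
    hKc.exists_bound_of_continuousOn (continuousOn_reForm_biv
      (continuous_curvMatrix_Q.comp_continuousOn hS) continuous_snd.continuousOn)
  obtain ⟨M₁, h₁⟩ := hbd (fun p => R p.1 + J) (hcR.add continuousOn_const)
  obtain ⟨M₂, h₂⟩ := hbd (fun p => R p.1) hcR
  obtain ⟨M₃, h₃⟩ := hbd (fun _ => J) continuousOn_const
  -- The factor multiplying δ in the expansion is at most M₁ + M₂ + (1 - δ)M₃.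
  refine ⟨|M₁ + M₂ + M₃|, abs_nonneg _, fun t ht z w hzw δ hδ0 hδ1 => ?_⟩
  have hp : (t, z, w) ∈ K := ⟨ht, hzw⟩
  have b₁ := h₁ _ hp
  have b₂ := h₂ _ hp
  have b₃ := h₃ _ hp
  rw [Real.norm_eq_abs] at b₁ b₂ b₃
  rw [curvMatrix_Q_add_smul, reForm_add_matrix, reForm_smul_matrix, reForm_add_matrix,
    reForm_add_matrix, reForm_smul_matrix, reForm_smul_matrix]
  refine add_le_add le_rfl (mul_le_mul_of_nonneg_left ?_ hδ0)
  have a₁ := le_of_abs_le b₁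
  have a₂ := neg_le_of_abs_le b₂
  have a₃ := neg_le_of_abs_le b₃
  have a₄ : 0 ≤ M₃ := (abs_nonneg _).trans b₃
  have a₅ := le_abs_self (M₁ + M₂ + M₃)
  dsimp only at a₁ a₂ a₃
  nlinarith

/-- At a first zero, Q of the perturbed operator is nonnegative on φ, so Q(R) ≥ -δL there with δ = ε
exp((L+1)t). The growth 16(L+1)δ of the perturbation outweighs this loss. The bound on ε keeps δ ≤
1, as the Lipschitz estimate requires. -/
theorem isoForm_add_exp_smul_constCurv_pos [DecidableEq ι] {R : ℝ → AlgCurv ι} {b L : ℝ}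
    (hR : ∀ t ∈ Set.Icc 0 b, HasDerivWithinAt R (Q (R t)) (Set.Icc 0 b) t)
    (h0 : ∀ z w, 0 ≤ isoForm (R 0) z w) (hL0 : 0 ≤ L)
    (hL : ∀ t ∈ Set.Icc 0 b, ∀ z w, IsUnitaryPair z w → ∀ δ : ℝ, 0 ≤ δ → δ ≤ 1 →
      reForm (curvMatrix (Q (R t + δ • constCurv ι))) (biv z w) (biv z w)
        ≤ reForm (curvMatrix (Q (R t))) (biv z w) (biv z w) + δ * L)
    {ε : ℝ} (hε : 0 < ε) (hε1 : ε * Real.exp ((L + 1) * b) ≤ 1) {t : ℝ} (ht : t ∈ Set.Icc 0 b)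
    {z w : ι → ℂ} (hzw : IsUnitaryPair z w) :
    0 < isoForm (R t + (ε * Real.exp ((L + 1) * t)) • constCurv ι) z w := by
  refine pos_of_deriv_pos_of_first_zero isCompact_isUnitaryPair
    (F := fun s p => isoForm (R s + (ε * Real.exp ((L + 1) * s)) • constCurv ι) p.1 p.2)
    ?_ ?_ ?_ t ht (z, w) hzw
  · refine continuousOn_isoForm (ContinuousOn.add ?_ ?_) continuous_snd.continuousOn
    · exact ContinuousOn.comp (t := Set.Icc 0 b) (fun t ht => (hR t ht).continuousWithinAt)
        continuous_fst.continuousOn fun p hp => hp.1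
    · have h1 : Continuous fun s : ℝ => ε * Real.exp ((L + 1) * s) := by fun_prop
      exact ((h1.comp continuous_fst).smul continuous_const).continuousOn
  · intro p hp
    rw [isoForm_add_smul, reForm_constCurv hp]
    have := h0 p.1 p.2
    positivity
  · intro s hs hnn p hp hz
    set δ := ε * Real.exp ((L + 1) * s) with hδ
    have hδ0 : 0 < δ := by positivity
    have hδ1 : δ ≤ 1 := by
      refine le_trans ?_ hε1
      have := hs.2
      rw [hδ]
      gcongr
    have hQ := reForm_Q_nonneg (isoForm_nonneg_of_isUnitaryPair fun z w h => hnn (z, w) h) hz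
    have hQL := hL s hs p.1 p.2 hp δ hδ0.le hδ1
    refine ⟨reForm (curvMatrix (Q (R s))) (biv p.1 p.2) (biv p.1 p.2)
      + ε * (Real.exp ((L + 1) * s) * (L + 1)) * 16, ?_, ?_⟩
    · have h4 : ε * (Real.exp ((L + 1) * s) * (L + 1)) * 16
          = δ * L + (δ * L * 15 + δ * 16) := by
        rw [hδ]
        ring
      have h6 : 0 ≤ δ * L := by positivity
      linarith
    · have hexp : HasDerivAt (fun s => ε * Real.exp ((L + 1) * s))
          (ε * (Real.exp ((L + 1) * s) * (L + 1))) s := by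
        have := ((hasDerivAt_id s).const_mul (L + 1)).exp.const_mul ε
        simpa using this
      have h1 := (hasDerivWithinAt_isoForm (hR s hs) p.1 p.2).add
        ((hexp.hasDerivWithinAt (s := Set.Icc 0 b)).mul_const 16)
      refine h1.congr_of_mem (fun r _ => ?_) hs
      rw [isoForm_add_smul, reForm_constCurv hp]
      rfl

theorem isoForm_nonneg_of_ode [DecidableEq ι] {R : ℝ → AlgCurv ι} {b : ℝ}
    (hR : ∀ t ∈ Set.Icc 0 b, HasDerivWithinAt R (Q (R t)) (Set.Icc 0 b) t)
    (h0 : ∀ z w, 0 ≤ isoForm (R 0) z w) {t : ℝ} (ht : t ∈ Set.Icc 0 b) (z w : ι → ℂ) :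
    0 ≤ isoForm (R t) z w := by
  obtain ⟨L, hL0, hL⟩ := exists_Q_add_smul_le
    (fun t ht => (hR t ht).continuousWithinAt) (constCurv ι)
  refine isoForm_nonneg_of_isUnitaryPair (fun z w h => ?_) z w
  refine le_of_forall_pos_le_add fun η hη => ?_
  obtain ⟨ε, hε, h1, h2⟩ : ∃ ε : ℝ, 0 < ε ∧ ε * Real.exp ((L + 1) * b) ≤ 1 ∧
      ε * Real.exp ((L + 1) * t) * 16 ≤ η := by
    -- The first entry keeps the perturbation coefficient at most 1 up to time b; the second keeps
    -- its effect at time t, 16 times the coefficient, below η.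
    refine ⟨min (1 / Real.exp ((L + 1) * b)) (η / (Real.exp ((L + 1) * t) * 16)),
      by positivity, ?_, ?_⟩
    · rw [← le_div_iff₀ (Real.exp_pos _)]
      exact min_le_left _ _
    · rw [mul_assoc, ← le_div_iff₀ (by positivity)]
      exact min_le_right _ _
  have h3 := isoForm_add_exp_smul_constCurv_pos hR h0 hL0 hL hε h1 ht h
  rw [isoForm_add_smul, reForm_constCurv h] at h3
  linarith

end

end AlgCurv

theorem mainTheorem4 (n : ℕ) (T : EReal) (R : ℝ → AlgCurv (Fin n))
    (hR : ∀ t : ℝ, 0 ≤ t → (t : EReal) < T →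
      HasDerivWithinAt R (AlgCurv.Q (R t)) {s : ℝ | 0 ≤ s ∧ (s : EReal) < T} t)
    (h0 : R 0 ∈ AlgCurv.E n) :
    ∀ t : ℝ, 0 ≤ t → (t : EReal) < T → R t ∈ AlgCurv.E n := by
  intro t ht htT
  rw [AlgCurv.mem_E_iff] at h0 ⊢
  have hlt : ∀ s ∈ Set.Icc 0 t, (s : EReal) < T := fun s hs =>
    (EReal.coe_le_coe_iff.2 hs.2).trans_lt htT
  exact AlgCurv.isoForm_nonneg_of_ode
    (fun s hs => (hR s hs.1 (hlt s hs)).mono fun r hr => ⟨hr.1, hlt r hr⟩) h0 ⟨ht, le_rfl⟩
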